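/- Let $n>k$, let $x_{t-n+1},\dots,x_t\in\mathbb R^k$ be observed asset returns, modelled as independent $\mathcal N_k(\mu,\Sigma)$ vectors given $(\mu,\Sigma)$ with $\Sigma$ positive definite, and let $X_{t+1}\mid\mu,\Sigma\sim\mathcal N_k(\mu,\Sigma)$ be conditionally independent of them. Put $\bar x_t=\frac1n\sum_i x_i$, $S_t=\frac1{n-1}\sum_i (x_i-\bar x_t)(x_i-\bar x_t)^\top$ and $S_{t,d}=(n-1)S_t$. For a prior density $\pi(\mu,\Sigma)$, let the posterior be the normalization of $L(x\mid\mu,\Sigma)\,\pi(\mu,\Sigma)\,d\mu\,d\Sigma$, where $L$ is the likelihood and $d\Sigma=\prod_{i\le j}d\sigma_{ij}$ on positive definite matrices. For given weights $v_t\in\mathbb R^k$, current wealth $W_t\in\mathbb R$ and risk-free return $r_{f,t+1}\in\mathbb R$, let $\widehat W_{t+1}$ have the posterior predictive distribution of $W_{t+1}=W_t\big(1+r_{f,t+1}+v_t^\top(X_{t+1}-r_{f,t+1}\mathbf 1)\big)$, i.e. the mixture of the conditional laws of $W_{t+1}$ given $(\mu,\Sigma)$ over the posterior. Let $t_\delta$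 denote the standard Student $t$-distribution with $\delta$ degrees of freedom. (a) Under the diffuse prior $\pi(\mu,\Sigma)\propto|\Sigma|^{-(k+1)/2}$, if $S_{t,d}$ is positive definite, then the posterior is a proper probability distribution and $$\widehat W_{t+1}\stackrel d= W_t\Big(1+r_{f,t+1}+v_t^\top(\bar x_t-r_{f,t+1}\mathbf 1)+\sqrt{v_t^\top S_{t,d}v_t}\Big(\tfrac{t_1}{\sqrt{n(n-k)}}+\sqrt{1+\tfrac{t_1^2}{n-k}}\,\tfrac{t_2}{\sqrt{n-k+1}}\Big)\Big),$$ where $t_1\sim t_{n-k}$ and $t_2\sim t_{n-k+1}$ are independent. (b) Under the conjugate prior $\mu\mid\Sigma\sim\mathcal N_k(m_0,\Sigma/r_0)$, $\Sigma\sim\mathcal{IW}_k(d_0,S_0)$, with $m_0\in\mathbb R^k$, $r_0>0$, $d_0>2k$ and $S_0$ positive definite, where $\mathcal{IW}_k(d_0,S_0)$ is the inverse Wishart distribution with density proportional to $|\Sigma|^{-d_0/2}\exp(-\frac12\operatorname{tr}(\Sigma^{-1}S_0))$, the posterior is a proper probability distribution and $$\widehat W_{t+1}\stackrel d= W_t\Big(1+r_{f,t+1}+v_t^\top(\bar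 x_{t,c}-r_{f,t+1}\mathbf 1)+\sqrt{v_t^\top S_{t,c}v_t}\Big(\tfrac{t_1}{\sqrt{(n+r_0)(n+d_0-2k)}}+\sqrt{1+\tfrac{t_1^2}{n+d_0-2k}}\,\tfrac{t_2}{\sqrt{n+d_0-2k+1}}\Big)\Big),$$ where $\bar x_{t,c}=\frac{n\bar x_t+r_0m_0}{n+r_0}$, $S_{t,c}=S_{t,d}+S_0+\frac{nr_0}{n+r_0}(m_0-\bar x_t)(m_0-\bar x_t)^\top$, and $t_1\sim t_{n+d_0-2k}$ and $t_2\sim t_{n+d_0-2k+1}$ are independent. -/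

import Mathlib

open MeasureTheory ProbabilityTheory
open scoped Matrix ENNReal

noncomputable section

namespace BayesPortfolio

/-- The standard univariate Student `t`-distribution with `d` degrees of freedom: the law of
`Z / √(V / d)` with `Z ∼ N(0, 1)` and `V ∼ χ²_d = Gamma(d / 2, 1 / 2)` independent. -/
def studentT (d : ℝ) : Measure ℝ :=
  ((gaussianReal 0 1).prod (gammaMeasure (d / 2) (1 / 2))).map
    (fun p : ℝ × ℝ => p.1 / √(p.2 / d))

/-- Density (with respect to Lebesgue measure on `ℝᵏ`) of the `k`-dimensional normal distribution
`N_k(μ, Σ)`, for positive definite `Σ`. -/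
def normalDensity {k : ℕ} (μ : Fin k → ℝ) (Sg : Matrix (Fin k) (Fin k) ℝ) (y : Fin k → ℝ) : ℝ :=
  (2 * Real.pi) ^ (-(k : ℝ) / 2) * Sg.det ^ (-(1 : ℝ) / 2) *
    Real.exp (-(1 / 2) * ((y - μ) ⬝ᵥ (Sg⁻¹ *ᵥ (y - μ))))

/-- The normal distribution `N_k(μ, Σ)`, for positive definite `Σ`. -/
def normalLaw {k : ℕ} (μ : Fin k → ℝ) (Sg : Matrix (Fin k) (Fin k) ℝ) : Measure (Fin k → ℝ) :=
  volume.withDensity (fun y => ENNReal.ofReal (normalDensity μ Sg y))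

/-- The multivariate gamma function `Γ_k(a) = π^(k(k-1)/4) ∏_{i=1}^k Γ(a - (i-1)/2)`. -/
def multivariateGamma (k : ℕ) (a : ℝ) : ℝ :=
  Real.pi ^ ((k : ℝ) * ((k : ℝ) - 1) / 4) * ∏ i : Fin k, Real.Gamma (a - (i : ℝ) / 2)

/-- Density of the inverse Wishart distribution `IW_k(m, Ψ)` (with `m > 2k` and `Ψ` positive
definite), in the parametrization in which it is proportional to
`|Σ|^(-m/2) exp(-tr(Σ⁻¹ Ψ)/2)`, with respect to Lebesgue measure on symmetric matrices. -/
def invWishartDensity {k : ℕ} (m : ℝ) (Ps Sg : Matrix (Fin k) (Fin k) ℝ) : ℝ :=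
  (2 : ℝ) ^ (-((m - k - 1) * k / 2)) * Ps.det ^ ((m - k - 1) / 2) /
      multivariateGamma k ((m - k - 1) / 2) *
    Sg.det ^ (-m / 2) * Real.exp (-(1 / 2) * (Sg⁻¹ * Ps).trace)

/-- The sample mean. -/
def sampleMean {k n : ℕ} (x : Fin n → Fin k → ℝ) : Fin k → ℝ :=
  (n : ℝ)⁻¹ • ∑ i, x i

/-- The sample covariance matrix. -/
def sampleCov {k n : ℕ} (x : Fin n → Fin k → ℝ) : Matrix (Fin k) (Fin k) ℝ :=
  ((n : ℝ) - 1)⁻¹ • ∑ i, Matrix.vecMulVec (x i - sampleMean x) (x i - sampleMean x)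

/-- `S_{t,d} = (n - 1) S_t`. -/
def diffuseScale {k n : ℕ} (x : Fin n → Fin k → ℝ) : Matrix (Fin k) (Fin k) ℝ :=
  ((n : ℝ) - 1) • sampleCov x

/-- `x̄_{t,c} = (n x̄_t + r₀ m₀) / (n + r₀)`. -/
def conjugateMean {k n : ℕ} (x : Fin n → Fin k → ℝ) (m₀ : Fin k → ℝ) (r₀ : ℝ) : Fin k → ℝ :=
  ((n : ℝ) + r₀)⁻¹ • ((n : ℝ) • sampleMean x + r₀ • m₀)

/-- `S_{t,c} = S_{t,d} + S₀ + (n r₀ / (n + r₀)) (m₀ - x̄_t)(m₀ - x̄_t)ᵀ`. -/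
def conjugateScale {k n : ℕ} (x : Fin n → Fin k → ℝ) (m₀ : Fin k → ℝ) (r₀ : ℝ)
    (S₀ : Matrix (Fin k) (Fin k) ℝ) : Matrix (Fin k) (Fin k) ℝ :=
  diffuseScale x + S₀ +
    ((n : ℝ) * r₀ / ((n : ℝ) + r₀)) •
      Matrix.vecMulVec (m₀ - sampleMean x) (m₀ - sampleMean x)

/-- The symmetric matrix with given entries, one for each unordered pair of indices. -/
def symMatrix {k : ℕ} (s : Sym2 (Fin k) → ℝ) : Matrix (Fin k) (Fin k) ℝ :=
  Matrix.of fun i j => s s(i, j)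

/-- The pairs `(μ, Σ)`, with the symmetric matrix `Σ` given by its `k(k+1)/2` entries `σ_ij`,
`i ≤ j`. The volume is Lebesgue measure `dμ dΣ = ∏ dμ_i ∏_{i ≤ j} dσ_ij`. -/
abbrev Param (k : ℕ) : Type := (Fin k → ℝ) × (Sym2 (Fin k) → ℝ)

/-- The likelihood of `(μ, Σ)` for independent observations `x_i ∼ N_k(μ, Σ)`. -/
def likelihood {k n : ℕ} (x : Fin n → Fin k → ℝ) (μ : Fin k → ℝ)
    (Sg : Matrix (Fin k) (Fin k) ℝ) : ℝ :=
  ∏ i, normalDensity μ Sg (x i)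

/-- The diffuse (Jeffreys) prior `π(μ, Σ) ∝ |Σ|^(-(k+1)/2)`. -/
def diffusePrior {k : ℕ} (_μ : Fin k → ℝ) (Sg : Matrix (Fin k) (Fin k) ℝ) : ℝ :=
  Sg.det ^ (-((k : ℝ) + 1) / 2)

/-- Density of the conjugate prior `μ | Σ ∼ N_k(m₀, Σ / r₀)`, `Σ ∼ IW_k(d₀, S₀)`. -/
def conjugatePrior {k : ℕ} (m₀ : Fin k → ℝ) (r₀ d₀ : ℝ) (S₀ : Matrix (Fin k) (Fin k) ℝ)
    (μ : Fin k → ℝ) (Sg : Matrix (Fin k) (Fin k) ℝ) : ℝ :=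
  normalDensity m₀ (r₀⁻¹ • Sg) μ * invWishartDensity d₀ S₀ Sg

/-- The measure `L(x | μ, Σ) π(μ, Σ) dμ dΣ` on the set of `(μ, Σ)` with `Σ` positive definite. -/
def unnormalizedPosterior {k n : ℕ} (x : Fin n → Fin k → ℝ)
    (prior : (Fin k → ℝ) → Matrix (Fin k) (Fin k) ℝ → ℝ) : Measure (Param k) :=
  (volume.restrict {θ : Param k | (symMatrix θ.2).PosDef}).withDensity
    (fun θ => ENNReal.ofReal
      (likelihood x θ.1 (symMatrix θ.2) * prior θ.1 (symMatrix θ.2)))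

/-- The posterior distribution of `(μ, Σ)` given the data `x`: the normalization of
`L(x | μ, Σ) π(μ, Σ) dμ dΣ`. It is a probability measure if and only if the total mass of the
latter is neither `0` nor `∞`. -/
def posterior {k n : ℕ} (x : Fin n → Fin k → ℝ)
    (prior : (Fin k → ℝ) → Matrix (Fin k) (Fin k) ℝ → ℝ) : Measure (Param k) :=
  (unnormalizedPosterior x prior Set.univ)⁻¹ • unnormalizedPosterior x prior

/-- The wealth `W_{t+1} = W_t (1 + r_f + vᵀ (X_{t+1} - r_f 1))`. -/
def wealth {k : ℕ} (W rf : ℝ) (v X : Fin k → ℝ) : ℝ :=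
  W * (1 + rf + v ⬝ᵥ (X - fun _ => rf))

/-- The conditional law of `W_{t+1}` given `(μ, Σ)`, for `X_{t+1} | μ, Σ ∼ N_k(μ, Σ)`. -/
def wealthLaw {k : ℕ} (W rf : ℝ) (v : Fin k → ℝ) (θ : Param k) : Measure ℝ :=
  (normalLaw θ.1 (symMatrix θ.2)).map (wealth W rf v)

lemma measurable_normalDensity {k : ℕ} :
    Measurable (fun p : Param k × (Fin k → ℝ) =>
      normalDensity p.1.1 (symMatrix p.1.2) p.2) := by
  have hc : Continuous (fun p : Param k × (Fin k → ℝ) => symMatrix p.1.2) := by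
    refine continuous_matrix fun i j => ?_
    simp only [symMatrix, Matrix.of_apply]
    fun_prop
  have hdet : Measurable (fun p : Param k × (Fin k → ℝ) => (symMatrix p.1.2).det) :=
    hc.matrix_det.measurable
  have hinv : ∀ i j, Measurable
      (fun p : Param k × (Fin k → ℝ) => (symMatrix p.1.2)⁻¹ i j) := by
    intro i j
    simp only [Matrix.inv_def, Ring.inverse_eq_inv', Matrix.smul_apply, smul_eq_mul]
    exact hdet.inv.mul ((hc.matrix_adjugate.matrix_elem i j).measurable)
  unfold normalDensity
  simp only [dotProduct, Matrix.mulVec]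
  refine ((measurable_const.mul (hdet.pow_const _)).mul (Real.measurable_exp.comp ?_))
  refine measurable_const.mul (Finset.measurable_sum _ fun i _ => ?_)
  refine Measurable.mul (by fun_prop) (Finset.measurable_sum _ fun j _ => ?_)
  exact (hinv i j).mul (by fun_prop)

/-- The conditional law of the wealth is a measurable function of `(μ, Σ)`, so that the mixture
below is the intended one. -/
lemma measurable_wealthLaw {k : ℕ} (W rf : ℝ) (v : Fin k → ℝ) :
    Measurable (wealthLaw W rf v) := by
  have hw : Measurable (wealth W rf v) := by
    unfold wealth dotProduct
    fun_prop
  have hn : Measurable (fun θ : Param k => normalLaw θ.1 (symMatrix θ.2)) := by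
    refine Measure.measurable_of_measurable_coe _ fun s hs => ?_
    simp only [normalLaw, withDensity_apply _ hs]
    exact Measurable.lintegral_prod_right measurable_normalDensity.ennreal_ofReal
  exact (Measure.measurable_map _ hw).comp hn

/-- The posterior predictive distribution of the wealth `W_{t+1}` given the data `x`: the mixture
of the conditional laws of `W_{t+1}` given `(μ, Σ)` over the posterior of `(μ, Σ)`. -/
def predictiveWealth {k n : ℕ} (x : Fin n → Fin k → ℝ)
    (prior : (Fin k → ℝ) → Matrix (Fin k) (Fin k) ℝ → ℝ) (W rf : ℝ) (v : Fin k → ℝ) :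
    Measure ℝ :=
  (posterior x prior).bind (wealthLaw W rf v)

end BayesPortfolio

end

/-!
Both posteriors are normal-inverse-Wishart: completing the square in `μ` shows that `Σ` is inverse
Wishart and that, given `Σ`, `μ` is normal with covariance `Σ / r`. Given `(μ, Σ)` the wealth is
normal and depends on `(μ, Σ)` only through `vᵀ μ` and `vᵀ Σ v`, so the inverse Wishart
distribution enters only through the law of `vᵀ Σ v`. That law is `vᵀ S v / U` with `U` a
chi-squared variable: congruence invariance reduces the claim to a diagonal entry of `Σ` for
`S = 1`, which splits off in Schur complement coordinates.

The predictive wealth thus is affine in `Y / √U` and `Z / √U`, with `Y`, `Z` standard normal and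
independent of `U ∼ χ²_d`. The pair of quotients is not independent, but given `Y / √U = a` the
variable `(1 + a²) U` is chi-squared with `d + 1` degrees of freedom, so that `Z / √U` is
`√(1 + a²)` times an independent Student variable with `d + 1` degrees of freedom, up to scale.
-/

namespace BayesPortfolio

open scoped NNReal

section ImageMeasures

variable {α β : Type*} [MeasurableSpace α] [MeasurableSpace β]

lemma map_withDensity_comp (μ : Measure α) {Φ : α → β} (hΦ : Measurable Φ) {f : β → ℝ≥0∞}
    (hf : Measurable f) : (μ.withDensity (f ∘ Φ)).map Φ = (μ.map Φ).withDensity f := by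
  ext s hs
  rw [Measure.map_apply hΦ hs, withDensity_apply _ (hΦ hs), withDensity_apply _ hs,
    setLIntegral_map hs hf hΦ]
  rfl

lemma map_fst_prod_withDensity (μ : Measure α) (ν : Measure β) [SFinite μ] [SFinite ν]
    {f : α × β → ℝ≥0∞} (hf : Measurable f) :
    ((μ.prod ν).withDensity f).map Prod.fst = μ.withDensity fun x => ∫⁻ y, f (x, y) ∂ν := by
  ext s hs
  rw [Measure.map_apply measurable_fst hs, withDensity_apply _ (measurable_fst hs),
    withDensity_apply _ hs, ← Set.prod_univ, setLIntegral_prod _ hf.aemeasurable]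
  simp only [Measure.restrict_univ]

lemma exists_eq_smul_map_linearEquiv {E G : Type*} [NormedAddCommGroup E] [NormedSpace ℝ E]
    [FiniteDimensional ℝ E] [MeasurableSpace E] [BorelSpace E] [NormedAddCommGroup G]
    [NormedSpace ℝ G] [MeasurableSpace G] [BorelSpace G] (μ : Measure E) [μ.IsAddHaarMeasure]
    (ν : Measure G) [ν.IsAddHaarMeasure] (e : E ≃ₗ[ℝ] G) :
    ∃ c : ℝ≥0, c ≠ 0 ∧ ν = c • μ.map e := by
  have := e.finiteDimensional
  have := e.toContinuousLinearEquiv.isAddHaarMeasure_map μ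
  exact ⟨_, (Measure.addHaarScalarFactor_pos_of_isAddHaarMeasure ν (μ.map e)).ne',
    Measure.isAddLeftInvariant_eq_smul ν (μ.map e)⟩

lemma lintegral_fin_nat_prod_eq_prod {n : ℕ} {E : Fin n → Type*} [∀ i, MeasurableSpace (E i)]
    (μ : ∀ i, Measure (E i)) [∀ i, SigmaFinite (μ i)] {f : ∀ i, E i → ℝ≥0∞}
    (hf : ∀ i, Measurable (f i)) :
    ∫⁻ x, ∏ i, f i (x i) ∂Measure.pi μ = ∏ i, ∫⁻ y, f i y ∂μ i := by
  induction n with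
  | zero => simp
  | succ n ih =>
    have htail : Measurable fun x : ∀ i : Fin n, E i.succ => ∏ i, f i.succ (x i) :=
      Finset.measurable_prod _ fun i _ => (hf i.succ).comp (measurable_pi_apply i)
    calc ∫⁻ x, ∏ i, f i (x i) ∂Measure.pi μ
        = ∫⁻ x : E 0 × (∀ i : Fin n, E i.succ), f 0 x.1 * ∏ i : Fin n, f i.succ (x.2 i)
            ∂(μ 0).prod (Measure.pi fun i => μ i.succ) := by
          simp only [Fin.prod_univ_succ]
          exact (measurePreserving_piFinSuccAbove μ 0).lintegral_comp
            (((hf 0).comp measurable_fst).mul (htail.comp measurable_snd))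
      _ = ∏ i, ∫⁻ y, f i y ∂μ i := by
          rw [lintegral_prod_mul (hf 0).aemeasurable htail.aemeasurable, ih _ fun i => hf i.succ,
            Fin.prod_univ_succ]

lemma pi_withDensity {n : ℕ} {E : Fin n → Type*} [∀ i, MeasurableSpace (E i)]
    (μ : ∀ i, Measure (E i)) [∀ i, SigmaFinite (μ i)] {f : ∀ i, E i → ℝ≥0∞}
    (hf : ∀ i, Measurable (f i)) [∀ i, SigmaFinite ((μ i).withDensity (f i))] :
    Measure.pi (fun i => (μ i).withDensity (f i)) =
      (Measure.pi μ).withDensity fun x => ∏ i, f i (x i) := by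
  refine Measure.pi_eq fun s hs => ?_
  rw [withDensity_apply _ (.univ_pi hs), Measure.restrict_pi_pi,
    lintegral_fin_nat_prod_eq_prod _ hf]
  exact Finset.prod_congr rfl fun i _ => (withDensity_apply _ (hs i)).symm

end ImageMeasures

section Factorization

variable {ι : Type*} [Fintype ι] [DecidableEq ι]

open scoped MatrixOrder in
lemma exists_mul_transpose_eq {S : Matrix ι ι ℝ} (hS : S.PosDef) :
    ∃ A : Matrix ι ι ℝ, A.det ≠ 0 ∧ A * Aᵀ = S := by
  have hsqrt : CFC.sqrt S * (CFC.sqrt S)ᵀ = S := by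
    rw [← Matrix.conjTranspose_eq_transpose_of_trivial,
      (Matrix.nonneg_iff_posSemidef.mp (CFC.sqrt_nonneg S)).isHermitian.eq, ← pow_two,
      CFC.sq_sqrt S hS.posSemidef.nonneg]
  refine ⟨CFC.sqrt S, fun h => hS.det_pos.ne' ?_, hsqrt⟩
  rw [← hsqrt, Matrix.det_mul, h, zero_mul]

omit [DecidableEq ι] in
lemma exists_orthonormalBasis_norm_smul_eq (i : ι) (u : EuclideanSpace ℝ ι) :
    ∃ b : OrthonormalBasis ι ℝ (EuclideanSpace ℝ ι), ‖u‖ • b i = u := by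
  classical
  by_cases hu : ‖u‖ = 0
  · exact ⟨EuclideanSpace.basisFun ι ℝ, by rw [hu, zero_smul, norm_eq_zero.mp hu]⟩
  · have hunit : Orthonormal ℝ (({i} : Set ι).domRestrict fun _ => ‖u‖⁻¹ • u) :=
      ⟨fun _ => by simp [norm_smul, hu], fun j l hjl => (hjl (Subsingleton.elim j l)).elim⟩
    obtain ⟨b, hb⟩ := hunit.exists_orthonormalBasis_extension_of_card_eq (by simp)
    exact ⟨b, by rw [hb i rfl, smul_inv_smul₀ hu]⟩

lemma exists_mul_transpose_eq_one_and_vecMul_eq_single (i : ι) (w : ι → ℝ) :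
    ∃ O : Matrix ι ι ℝ, O * Oᵀ = 1 ∧ w ᵥ* O = Pi.single i √(w ⬝ᵥ w) := by
  obtain ⟨b, hb⟩ := exists_orthonormalBasis_norm_smul_eq i (WithLp.toLp 2 w)
  have hnorm : ‖WithLp.toLp 2 w‖ = √(w ⬝ᵥ w) := by
    simp [EuclideanSpace.norm_eq, dotProduct, pow_two]
  have hinner : ∀ j l, (b j).ofLp ⬝ᵥ (b l).ofLp = if j = l then 1 else 0 := fun j l => by
    rw [← b.inner_eq_ite, EuclideanSpace.inner_eq_star_dotProduct, star_trivial, dotProduct_comm]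
  refine ⟨(Matrix.of fun j => (b j).ofLp)ᵀ, ?_, ?_⟩
  · rw [Matrix.transpose_transpose, mul_eq_one_comm]
    ext j l
    exact (hinner j l).trans Matrix.one_apply.symm
  · ext j
    have hw : w = √(w ⬝ᵥ w) • (b i).ofLp := by rw [← hnorm, ← WithLp.ofLp_smul, hb]
    calc w ⬝ᵥ (b j).ofLp = √(w ⬝ᵥ w) * ((b i).ofLp ⬝ᵥ (b j).ofLp) := by
          nth_rw 1 [hw, smul_dotProduct, smul_eq_mul]
      _ = (Pi.single i √(w ⬝ᵥ w) : ι → ℝ) j := by simp [hinner, Pi.single_apply, eq_comm]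

lemma exists_mul_transpose_eq_and_vecMul_eq_single {S : Matrix ι ι ℝ} (hS : S.PosDef) (i : ι)
    (v : ι → ℝ) : ∃ A : Matrix ι ι ℝ, A.det ≠ 0 ∧ A * Aᵀ = S ∧
      v ᵥ* A = Pi.single i √(v ⬝ᵥ (S *ᵥ v)) := by
  obtain ⟨B, hB, rfl⟩ := exists_mul_transpose_eq hS
  obtain ⟨O, hO, hw⟩ := exists_mul_transpose_eq_one_and_vecMul_eq_single i (v ᵥ* B)
  refine ⟨B * O, ?_, ?_, ?_⟩
  · rw [Matrix.det_mul]
    exact mul_ne_zero hB (Matrix.det_ne_zero_of_right_inverse hO)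
  · rw [Matrix.transpose_mul, Matrix.mul_assoc, ← Matrix.mul_assoc O, hO, Matrix.one_mul]
  · rw [← Matrix.vecMul_vecMul, hw, ← Matrix.mulVec_mulVec, Matrix.dotProduct_mulVec,
      Matrix.mulVec_transpose]

end Factorization

section Normal

variable {k : ℕ}

lemma normalDensity_mul_transpose (μ z : Fin k → ℝ) {A : Matrix (Fin k) (Fin k) ℝ}
    (hA : A.det ≠ 0) :
    normalDensity μ (A * Aᵀ) (μ + A *ᵥ z) = |A.det|⁻¹ * normalDensity 0 1 z := by
  have hdet : (A * Aᵀ).det ^ (-(1 : ℝ) / 2) = |A.det|⁻¹ := by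
    rw [Matrix.det_mul, Matrix.det_transpose, ← abs_mul_abs_self, ← pow_two,
      ← Real.rpow_natCast, ← Real.rpow_mul (abs_nonneg _)]
    norm_num [Real.rpow_neg_one]
  have hform : (A *ᵥ z) ⬝ᵥ ((A * Aᵀ)⁻¹ *ᵥ (A *ᵥ z)) = z ⬝ᵥ z := by
    rw [Matrix.mul_inv_rev, Matrix.mulVec_mulVec, Matrix.mul_assoc,
      Matrix.nonsing_inv_mul _ hA.isUnit, Matrix.mul_one, Matrix.dotProduct_mulVec,
      ← Matrix.transpose_nonsing_inv, Matrix.vecMul_transpose, Matrix.mulVec_mulVec,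
      Matrix.nonsing_inv_mul _ hA.isUnit, Matrix.one_mulVec]
  simp only [normalDensity, hdet, hform, add_sub_cancel_left, sub_zero, inv_one, Matrix.det_one,
    Real.one_rpow, Matrix.one_mulVec]
  ring

lemma prod_gaussianPDF (z : Fin k → ℝ) :
    ∏ i, gaussianPDF 0 1 (z i) = ENNReal.ofReal (normalDensity 0 1 z) := by
  simp only [gaussianPDF]
  rw [← ENNReal.ofReal_prod_of_nonneg fun i _ => gaussianPDFReal_nonneg _ _ _]
  simp only [gaussianPDFReal, NNReal.coe_one, mul_one, sub_zero, Finset.prod_mul_distrib,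
    ← Real.exp_sum, Finset.prod_const, Finset.card_univ, Fintype.card_fin, normalDensity,
    Matrix.det_one, Real.one_rpow, inv_one, Matrix.one_mulVec, dotProduct, Finset.mul_sum]
  congr 2
  · rw [Real.sqrt_eq_rpow, ← Real.rpow_neg (by positivity), ← Real.rpow_natCast,
      ← Real.rpow_mul (by positivity)]
    congr 1
    ring
  · exact congrArg Real.exp (Finset.sum_congr rfl fun i _ => by ring)

lemma pi_gaussianReal_eq_normalLaw :
    Measure.pi (fun _ : Fin k => gaussianReal 0 1) = normalLaw 0 1 := by
  simp only [normalLaw, ← prod_gaussianPDF, gaussianReal_of_var_ne_zero 0 one_ne_zero]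
  have : SigmaFinite (volume.withDensity (gaussianPDF 0 1)) := by
    rw [← gaussianReal_of_var_ne_zero 0 one_ne_zero]
    infer_instance
  exact pi_withDensity _ fun _ => measurable_gaussianPDF 0 1

lemma measurable_normalDensity_right (μ : Fin k → ℝ) (S : Matrix (Fin k) (Fin k) ℝ) :
    Measurable (normalDensity μ S) := by
  unfold normalDensity dotProduct Matrix.mulVec dotProduct
  fun_prop

lemma map_normalLaw_zero_one (μ : Fin k → ℝ) {A : Matrix (Fin k) (Fin k) ℝ} (hA : A.det ≠ 0) :
    (normalLaw 0 1).map (fun z => μ + A *ᵥ z) = normalLaw μ (A * Aᵀ) := by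
  have hlin : Measurable fun z : Fin k → ℝ => A *ᵥ z :=
    (Matrix.toLin' A).continuous_of_finiteDimensional.measurable
  have hmap : (volume : Measure (Fin k → ℝ)).map (fun z => μ + A *ᵥ z) =
      ENNReal.ofReal |A.det|⁻¹ • volume := by
    rw [← abs_inv, ← map_add_left_eq_self (ENNReal.ofReal |A.det⁻¹| • volume) μ,
      ← Real.map_matrix_volume_pi_eq_smul_volume_pi hA]
    exact (Measure.map_map (measurable_const_add μ) hlin).symm
  have hdensity : (fun z => ENNReal.ofReal (normalDensity 0 1 z)) = ENNReal.ofReal |A.det| •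
      ((fun y => ENNReal.ofReal (normalDensity μ (A * Aᵀ) y)) ∘ fun z => μ + A *ᵥ z) := by
    ext z
    simp only [Pi.smul_apply, Function.comp_apply, smul_eq_mul]
    rw [← ENNReal.ofReal_mul (abs_nonneg _), normalDensity_mul_transpose μ z hA,
      mul_inv_cancel_left₀ (abs_ne_zero.mpr hA)]
  have hmeas := (measurable_normalDensity_right μ (A * Aᵀ)).ennreal_ofReal
  rw [normalLaw, hdensity, withDensity_smul _ (hmeas.comp (hlin.const_add μ)), Measure.map_smul,
    map_withDensity_comp _ (hlin.const_add μ) hmeas, hmap, withDensity_smul_measure, smul_smul,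
    ← ENNReal.ofReal_mul (abs_nonneg _), mul_inv_cancel₀ (abs_ne_zero.mpr hA), ENNReal.ofReal_one,
    one_smul, normalLaw]

lemma isProbabilityMeasure_normalLaw (μ : Fin k → ℝ) {S : Matrix (Fin k) (Fin k) ℝ}
    (hS : S.PosDef) : IsProbabilityMeasure (normalLaw μ S) := by
  obtain ⟨A, hA, rfl⟩ := exists_mul_transpose_eq hS
  rw [← map_normalLaw_zero_one μ hA, ← pi_gaussianReal_eq_normalLaw]
  refine Measure.isProbabilityMeasure_map (Measurable.aemeasurable ?_)
  exact (Matrix.toLin' A).continuous_of_finiteDimensional.measurable.const_add μ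

lemma map_dotProduct_normalLaw (v μ : Fin k → ℝ) {S : Matrix (Fin k) (Fin k) ℝ} (hS : S.PosDef) :
    (normalLaw μ S).map (fun y => v ⬝ᵥ y) =
      (gaussianReal 0 1).map (fun z => v ⬝ᵥ μ + √(v ⬝ᵥ (S *ᵥ v)) * z) := by
  cases k with
  | zero =>
    have := isProbabilityMeasure_normalLaw μ hS
    simp
  | succ k =>
    obtain ⟨A, hA, rfl, hv⟩ := exists_mul_transpose_eq_and_vecMul_eq_single hS 0 v
    have hlin : Measurable fun z : Fin (k + 1) → ℝ => A *ᵥ z :=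
      (Matrix.toLin' A).continuous_of_finiteDimensional.measurable
    rw [← map_normalLaw_zero_one μ hA, ← pi_gaussianReal_eq_normalLaw,
      Measure.map_map (by unfold dotProduct; fun_prop) (hlin.const_add μ)]
    have heval := measurePreserving_eval (fun _ : Fin (k + 1) => gaussianReal 0 1) 0
    nth_rw 2 [← heval.map_eq]
    rw [Measure.map_map (by fun_prop) heval.measurable]
    congr 1
    ext z
    simp only [Function.comp_apply, Function.eval]
    rw [dotProduct_add, Matrix.dotProduct_mulVec v A, hv, single_dotProduct]

end Normal

section SchurComplement

lemma posDef_fromBlocks_zero {ι κ : Type*} [Finite ι] [Finite κ] {A : Matrix κ κ ℝ}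
    {D : Matrix ι ι ℝ} : (Matrix.fromBlocks A 0 0 D).PosDef ↔ A.PosDef ∧ D.PosDef := by
  have := Fintype.ofFinite ι
  have := Fintype.ofFinite κ
  classical
  refine ⟨fun h => ⟨h.submatrix Sum.inl_injective, h.submatrix Sum.inr_injective⟩,
    fun ⟨hA, hD⟩ => ?_⟩
  have := hA.isUnit.invertible
  have hpsd : (Matrix.fromBlocks A 0 0 D).PosSemidef := by
    simpa using (hA.fromBlocks₁₁ 0 D).mpr (by simpa using hD.posSemidef)
  rw [hpsd.posDef_iff_det_ne_zero, Matrix.det_fromBlocks_zero₁₂]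
  exact mul_ne_zero hA.det_pos.ne' hD.det_pos.ne'

variable {ι : Type*} [Fintype ι] [DecidableEq ι]

/-- The unipotent block matrix `[[1, 0], [ℓ, 1]]`. -/
def lowerUnipotent (ℓ : ι → ℝ) : Matrix (Unit ⊕ ι) (Unit ⊕ ι) ℝ :=
  Matrix.fromBlocks 1 0 (Matrix.replicateCol Unit ℓ) 1

lemma det_lowerUnipotent (ℓ : ι → ℝ) : (lowerUnipotent ℓ).det = 1 := by
  simp [lowerUnipotent]

lemma lowerUnipotent_mul_lowerUnipotent_neg (ℓ : ι → ℝ) :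
    lowerUnipotent ℓ * lowerUnipotent (-ℓ) = 1 := by
  ext i j
  cases i <;> cases j <;> simp [lowerUnipotent, Matrix.fromBlocks_multiply, Matrix.one_apply]

/-- The symmetric matrix `[[σ, bᵀ], [b, D + σ⁻¹ b bᵀ]]`, given by its corner `σ`, the rest `b` of
its first column and the Schur complement `D` of the corner. -/
noncomputable def schurMatrix (σ : ℝ) (b : ι → ℝ) (D : Matrix ι ι ℝ) :
    Matrix (Unit ⊕ ι) (Unit ⊕ ι) ℝ :=
  Matrix.fromBlocks (Matrix.diagonal fun _ => σ) (Matrix.replicateRow Unit b)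
    (Matrix.replicateCol Unit b) (D + σ⁻¹ • Matrix.vecMulVec b b)

variable {σ : ℝ} (b : ι → ℝ) {D : Matrix ι ι ℝ}

lemma schurMatrix_eq_mul_mul_transpose (hσ : σ ≠ 0) (D : Matrix ι ι ℝ) :
    schurMatrix σ b D = lowerUnipotent (σ⁻¹ • b) *
      Matrix.fromBlocks (Matrix.diagonal fun _ => σ) 0 0 D * (lowerUnipotent (σ⁻¹ • b))ᵀ := by
  ext i j
  cases i <;> cases j <;>
    simp [schurMatrix, lowerUnipotent, Matrix.fromBlocks_transpose, Matrix.fromBlocks_multiply,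
      Matrix.vecMulVec_apply] <;> field_simp
  rw [Matrix.mul_apply]
  simp
  ring

lemma det_schurMatrix (hσ : σ ≠ 0) (D : Matrix ι ι ℝ) : (schurMatrix σ b D).det = σ * D.det := by
  simp [schurMatrix_eq_mul_mul_transpose b hσ, det_lowerUnipotent]

omit [Fintype ι] [DecidableEq ι] in
lemma posDef_schurMatrix [Finite ι] : (schurMatrix σ b D).PosDef ↔ 0 < σ ∧ D.PosDef := by
  have := Fintype.ofFinite ι
  classical
  by_cases hσ : 0 < σ
  · have hunit : IsUnit (lowerUnipotent (σ⁻¹ • b)) := by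
      rw [Matrix.isUnit_iff_isUnit_det, det_lowerUnipotent]
      exact isUnit_one
    rw [schurMatrix_eq_mul_mul_transpose b hσ.ne',
      ← Matrix.conjTranspose_eq_transpose_of_trivial, ← Matrix.star_eq_conjTranspose,
      Matrix.IsUnit.posDef_star_right_conjugate_iff hunit, posDef_fromBlocks_zero,
      Matrix.posDef_diagonal_iff]
    simp
  · exact ⟨fun h => (hσ (by simpa [schurMatrix] using h.diag_pos (i := Sum.inl ()))).elim,
      fun h => (hσ h.1).elim⟩

lemma inv_schurMatrix (hσ : σ ≠ 0) (hD : D.det ≠ 0) :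
    (schurMatrix σ b D)⁻¹ = (lowerUnipotent (-(σ⁻¹ • b)))ᵀ *
      Matrix.fromBlocks (Matrix.diagonal fun _ => σ⁻¹) 0 0 D⁻¹ *
      lowerUnipotent (-(σ⁻¹ • b)) := by
  have hL := lowerUnipotent_mul_lowerUnipotent_neg (σ⁻¹ • b)
  have hLt : (lowerUnipotent (σ⁻¹ • b))ᵀ * (lowerUnipotent (-(σ⁻¹ • b)))ᵀ = 1 := by
    rw [← Matrix.transpose_mul, mul_eq_one_comm.mp hL, Matrix.transpose_one]
  have hdiag : Matrix.fromBlocks (Matrix.diagonal fun _ : Unit => σ) 0 0 D *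
      Matrix.fromBlocks (Matrix.diagonal fun _ => σ⁻¹) 0 0 D⁻¹ = 1 := by
    simp [Matrix.fromBlocks_multiply, hσ, Matrix.mul_nonsing_inv _ hD.isUnit]
  refine Matrix.inv_eq_right_inv ?_
  rw [schurMatrix_eq_mul_mul_transpose b hσ]
  simp only [Matrix.mul_assoc]
  rw [← Matrix.mul_assoc _ _ (_ * lowerUnipotent _), hLt, Matrix.one_mul,
    ← Matrix.mul_assoc (Matrix.fromBlocks _ _ _ _), hdiag, Matrix.one_mul, hL]

lemma trace_inv_schurMatrix (hσ : σ ≠ 0) (hD : D.det ≠ 0) :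
    (schurMatrix σ b D)⁻¹.trace = σ⁻¹ + σ⁻¹ ^ 2 * (b ⬝ᵥ (D⁻¹ *ᵥ b)) + D⁻¹.trace := by
  rw [inv_schurMatrix b hσ hD]
  simp [lowerUnipotent, Matrix.fromBlocks_transpose, Matrix.fromBlocks_multiply, Matrix.trace,
    Matrix.mul_assoc, Matrix.mul_apply, dotProduct, Matrix.mulVec, Finset.mul_sum]
  ring_nf

end SchurComplement

section SymmetricMatrices

variable {k : ℕ}

lemma symMatrix_injective : Function.Injective (symMatrix (k := k)) := by
  intro s t h
  ext z
  induction z with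
  | _ i j => exact congrFun (congrFun h i) j

lemma transpose_symMatrix (s : Sym2 (Fin k) → ℝ) : (symMatrix s)ᵀ = symMatrix s := by
  ext i j
  simp [symMatrix, Sym2.eq_swap]

lemma continuous_symMatrix : Continuous (symMatrix (k := k)) :=
  continuous_matrix fun i j => continuous_apply s(i, j)

/-- The entries of the positive definite symmetric matrices, the domain on which priors and
posteriors of a covariance matrix live. -/
def posDefSet (k : ℕ) : Set (Sym2 (Fin k) → ℝ) := {s | (symMatrix s).PosDef}

lemma mem_posDefSet_iff (s : Sym2 (Fin k) → ℝ) : s ∈ posDefSet k ↔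
    (∀ x : Fin k → ℝ, 0 ≤ x ⬝ᵥ (symMatrix s *ᵥ x)) ∧ (symMatrix s).det ≠ 0 := by
  refine ⟨fun h => ⟨fun x => ?_, (Matrix.PosDef.det_pos h).ne'⟩, fun ⟨h, hdet⟩ => ?_⟩
  · simpa using (Matrix.PosDef.posSemidef h).dotProduct_mulVec_nonneg x
  · have hherm : (symMatrix s).IsHermitian := by
      rw [Matrix.IsHermitian, Matrix.conjTranspose_eq_transpose_of_trivial, transpose_symMatrix]
    exact (Matrix.PosSemidef.of_dotProduct_mulVec_nonneg hherm
      (by simpa using h)).posDef_iff_det_ne_zero.mpr hdet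

lemma measurableSet_posDefSet : MeasurableSet (posDefSet k) := by
  have hc := continuous_symMatrix (k := k)
  rw [show posDefSet k = {s | _} from Set.ext mem_posDefSet_iff]
  refine MeasurableSet.inter (IsClosed.measurableSet ?_)
    (isOpen_ne_fun hc.matrix_det continuous_const).measurableSet
  change IsClosed {s | ∀ x : Fin k → ℝ, 0 ≤ x ⬝ᵥ (symMatrix s *ᵥ x)}
  simp only [Set.ofPred_forall]
  exact isClosed_iInter fun x => isClosed_le continuous_const (by fun_prop)

/-- The congruence `Σ ↦ A Σ Aᵀ` on symmetric matrices. -/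
def symConj (A : Matrix (Fin k) (Fin k) ℝ) : (Sym2 (Fin k) → ℝ) →ₗ[ℝ] (Sym2 (Fin k) → ℝ) where
  toFun s := Sym2.lift ⟨fun i j => (A * symMatrix s * Aᵀ) i j, fun i j => by
    have : (A * symMatrix s * Aᵀ)ᵀ = A * symMatrix s * Aᵀ := by
      simp only [Matrix.transpose_mul, Matrix.transpose_transpose, transpose_symMatrix,
        Matrix.mul_assoc]
    exact congrFun (congrFun this j) i⟩
  map_add' s t := by
    have hadd : symMatrix (s + t) = symMatrix s + symMatrix t := rfl
    ext z
    induction z with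
    | _ i j => simp [hadd, Matrix.mul_add, Matrix.add_mul]
  map_smul' c s := by
    have hsmul : symMatrix (c • s) = c • symMatrix s := rfl
    ext z
    induction z with
    | _ i j => simp [hsmul]

lemma symMatrix_symConj (A : Matrix (Fin k) (Fin k) ℝ) (s : Sym2 (Fin k) → ℝ) :
    symMatrix (symConj A s) = A * symMatrix s * Aᵀ := rfl

lemma symConj_symConj (A B : Matrix (Fin k) (Fin k) ℝ) (s : Sym2 (Fin k) → ℝ) :
    symConj A (symConj B s) = symConj (A * B) s := by
  apply symMatrix_injective
  simp only [symMatrix_symConj, Matrix.transpose_mul, Matrix.mul_assoc]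

lemma symConj_one (s : Sym2 (Fin k) → ℝ) : symConj 1 s = s := by
  apply symMatrix_injective
  simp [symMatrix_symConj]

lemma measurable_symConj (A : Matrix (Fin k) (Fin k) ℝ) : Measurable (symConj A) :=
  (LinearMap.continuous_on_pi _).measurable

/-- The congruence by an invertible matrix, as a linear equivalence. -/
noncomputable def symConjEquiv {A : Matrix (Fin k) (Fin k) ℝ} (hA : A.det ≠ 0) :
    (Sym2 (Fin k) → ℝ) ≃ₗ[ℝ] (Sym2 (Fin k) → ℝ) :=
  LinearEquiv.ofLinearMap (symConj A) (symConj A⁻¹)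
    (LinearMap.ext fun s => by
      simp [symConj_symConj, symConj_one, Matrix.mul_nonsing_inv _ hA.isUnit])
    (LinearMap.ext fun s => by
      simp [symConj_symConj, symConj_one, Matrix.nonsing_inv_mul _ hA.isUnit])

lemma symConj_mem_posDefSet {A : Matrix (Fin k) (Fin k) ℝ} (hA : A.det ≠ 0)
    (s : Sym2 (Fin k) → ℝ) : symConj A s ∈ posDefSet k ↔ s ∈ posDefSet k := by
  have hu : IsUnit A := (Matrix.isUnit_iff_isUnit_det A).mpr hA.isUnit
  have := Matrix.IsUnit.posDef_star_right_conjugate_iff (x := symMatrix s) hu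
  rwa [Matrix.star_eq_conjTranspose, Matrix.conjTranspose_eq_transpose_of_trivial] at this

end SymmetricMatrices

section InverseWishart

/-- The unnormalized inverse Wishart density `|Σ|^(-m/2) exp(-tr(Σ⁻¹ Ψ)/2)`. -/
noncomputable def invWishartKernel {ι : Type*} [Fintype ι] [DecidableEq ι] (m : ℝ)
    (Ps Sg : Matrix ι ι ℝ) : ℝ :=
  Sg.det ^ (-m / 2) * Real.exp (-(1 / 2) * (Sg⁻¹ * Ps).trace)

lemma invWishartKernel_pos {ι : Type*} [Fintype ι] [DecidableEq ι] (m : ℝ) (Ps : Matrix ι ι ℝ)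
    {Sg : Matrix ι ι ℝ} (hS : Sg.PosDef) : 0 < invWishartKernel m Ps Sg := by
  have := hS.det_pos
  unfold invWishartKernel
  positivity

lemma invWishartKernel_one_submatrix {ι κ : Type*} [Fintype ι] [DecidableEq ι] [Fintype κ]
    [DecidableEq κ] (m : ℝ) (e : κ ≃ ι) (Sg : Matrix ι ι ℝ) :
    invWishartKernel m 1 (Sg.submatrix e e) = invWishartKernel m 1 Sg := by
  rw [invWishartKernel, invWishartKernel, Matrix.det_submatrix_equiv_self,
    Matrix.inv_submatrix_equiv, Matrix.mul_one, Matrix.mul_one]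
  congr 3
  exact e.sum_comp fun i => Sg⁻¹ i i

variable {k : ℕ}

lemma measurable_invWishartKernel (m : ℝ) (Ps : Matrix (Fin k) (Fin k) ℝ) :
    Measurable fun s => invWishartKernel m Ps (symMatrix s) := by
  have hdet := (continuous_symMatrix (k := k)).matrix_det.measurable
  have hinv : ∀ i j, Measurable fun s : Sym2 (Fin k) → ℝ => (symMatrix s)⁻¹ i j := by
    intro i j
    simp only [Matrix.inv_def, Ring.inverse_eq_inv', Matrix.smul_apply, smul_eq_mul]
    exact hdet.inv.mul (continuous_symMatrix.matrix_adjugate.matrix_elem i j).measurable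
  unfold invWishartKernel Matrix.trace
  simp only [Matrix.diag_apply, Matrix.mul_apply]
  refine (hdet.pow_const _).mul (Real.measurable_exp.comp (measurable_const.mul ?_))
  exact Finset.measurable_sum _ fun i _ => Finset.measurable_sum _ fun j _ =>
    (hinv i j).mul_const _

/-- The measure with density `invWishartKernel` on the positive definite matrices, that is,
the inverse Wishart distribution up to normalization. -/
noncomputable def invWishartMeasure (m : ℝ) (Ps : Matrix (Fin k) (Fin k) ℝ) :
    Measure (Sym2 (Fin k) → ℝ) :=
  (volume.restrict (posDefSet k)).withDensity
    fun s => ENNReal.ofReal (invWishartKernel m Ps (symMatrix s))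

lemma invWishartMeasure_eq_withDensity_indicator (m : ℝ) (Ps : Matrix (Fin k) (Fin k) ℝ) :
    invWishartMeasure m Ps = volume.withDensity ((posDefSet k).indicator
      fun s => ENNReal.ofReal (invWishartKernel m Ps (symMatrix s))) :=
  (withDensity_indicator measurableSet_posDefSet _).symm

lemma measurable_indicator_invWishartKernel (m : ℝ) (Ps : Matrix (Fin k) (Fin k) ℝ) :
    Measurable ((posDefSet k).indicator
      fun s => ENNReal.ofReal (invWishartKernel m Ps (symMatrix s))) :=
  (measurable_invWishartKernel m Ps).ennreal_ofReal.indicator measurableSet_posDefSet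

lemma invWishartKernel_symConj (m : ℝ) (Ps : Matrix (Fin k) (Fin k) ℝ)
    {A : Matrix (Fin k) (Fin k) ℝ} (hA : A.det ≠ 0) {s : Sym2 (Fin k) → ℝ}
    (hs : s ∈ posDefSet k) :
    invWishartKernel m (A * Ps * Aᵀ) (symMatrix (symConj A s)) =
      (A.det ^ 2) ^ (-m / 2) * invWishartKernel m Ps (symMatrix s) := by
  have htrace : ((A * symMatrix s * Aᵀ)⁻¹ * (A * Ps * Aᵀ)).trace =
      ((symMatrix s)⁻¹ * Ps).trace := by
    rw [Matrix.mul_inv_rev, Matrix.mul_inv_rev, ← Matrix.mul_assoc, Matrix.trace_mul_comm,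
      Matrix.mul_assoc Aᵀ⁻¹, Matrix.mul_assoc _ A⁻¹, Matrix.nonsing_inv_mul_cancel_left _ _
      hA.isUnit, Matrix.mul_nonsing_inv_cancel_left _ _ (by simpa using hA)]
  have hdet : (A * symMatrix s * Aᵀ).det = A.det ^ 2 * (symMatrix s).det := by
    rw [Matrix.det_mul, Matrix.det_mul, Matrix.det_transpose]
    ring
  rw [invWishartKernel, symMatrix_symConj, htrace, hdet,
    Real.mul_rpow (sq_nonneg _) (Matrix.PosDef.det_pos hs).le, invWishartKernel, mul_assoc]

lemma exists_invWishartMeasure_eq_smul_map_symConj (m : ℝ) (Ps : Matrix (Fin k) (Fin k) ℝ)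
    {A : Matrix (Fin k) (Fin k) ℝ} (hA : A.det ≠ 0) :
    ∃ c : ℝ≥0, c ≠ 0 ∧ invWishartMeasure m (A * Ps * Aᵀ) =
      c • (invWishartMeasure m Ps).map (symConj A) := by
  obtain ⟨c, hc, hvol⟩ := exists_eq_smul_map_linearEquiv
    (volume : Measure (Sym2 (Fin k) → ℝ)) volume (symConjEquiv hA)
  have hpos : 0 < (A.det ^ 2) ^ (-m / 2) := by positivity
  have hdens : (posDefSet k).indicator (fun s =>
        ENNReal.ofReal (invWishartKernel m (A * Ps * Aᵀ) (symMatrix s))) ∘ symConj A =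
      ENNReal.ofReal ((A.det ^ 2) ^ (-m / 2)) • (posDefSet k).indicator
        (fun s => ENNReal.ofReal (invWishartKernel m Ps (symMatrix s))) := by
    ext s
    by_cases hs : s ∈ posDefSet k
    · simp [(symConj_mem_posDefSet hA s).mpr hs, hs, invWishartKernel_symConj m Ps hA hs,
        ENNReal.ofReal_mul hpos.le]
    · simp [mt (symConj_mem_posDefSet hA s).mp hs, hs]
  refine ⟨c * ((A.det ^ 2) ^ (-m / 2)).toNNReal, mul_ne_zero hc (by simpa using hpos), ?_⟩
  rw [invWishartMeasure_eq_withDensity_indicator, invWishartMeasure_eq_withDensity_indicator]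
  nth_rewrite 1 [hvol]
  change ((c : ℝ≥0∞) • volume.map (symConj A)).withDensity _ = _
  rw [withDensity_smul_measure, ← map_withDensity_comp _ (measurable_symConj A)
    (measurable_indicator_invWishartKernel m _), hdens,
    withDensity_smul _ (measurable_indicator_invWishartKernel m _), Measure.map_smul, mul_smul]
  rfl

end InverseWishart

section SchurCoordinates

variable {k : ℕ}

/-- Separates the first index from the others. -/
def cornerEquiv (k : ℕ) : Fin (k + 1) ≃ Unit ⊕ Fin k :=
  (finSuccEquiv k).trans ((Equiv.optionEquivSumPUnit (Fin k)).trans (Equiv.sumComm _ _))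

lemma cornerEquiv_zero : cornerEquiv k 0 = Sum.inl () := rfl

lemma cornerEquiv_succ (i : Fin k) : cornerEquiv k i.succ = Sum.inr i := by
  simp [cornerEquiv]

/-- The decomposition of a symmetric matrix into its corner entry, the rest of its first column,
and the remaining diagonal block. -/
noncomputable def symBlocks (k : ℕ) :
    (Sym2 (Fin (k + 1)) → ℝ) ≃ₗ[ℝ] (ℝ × (Fin k → ℝ)) × (Sym2 (Fin k) → ℝ) where
  toFun s := ((s s(0, 0), fun i => s s(0, i.succ)), fun z => s (z.map Fin.succ))
  map_add' _ _ := rfl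
  map_smul' _ _ := rfl
  invFun p := Sym2.lift ⟨fun i j => Matrix.fromBlocks (Matrix.diagonal fun _ => p.1.1)
    (Matrix.replicateRow Unit p.1.2) (Matrix.replicateCol Unit p.1.2) (symMatrix p.2)
    (cornerEquiv k i) (cornerEquiv k j), fun i j => by
      cases hi : cornerEquiv k i <;> cases hj : cornerEquiv k j <;>
        simp [hi, hj, symMatrix, Sym2.eq_swap]⟩
  left_inv s := by
    ext z
    induction z with
    | _ i j =>
      cases i using Fin.cases <;> cases j using Fin.cases <;>
        simp [cornerEquiv_succ, cornerEquiv_zero, symMatrix, Sym2.eq_swap]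
  right_inv p := by
    refine Prod.ext (Prod.ext rfl (funext fun i => ?_)) (funext fun z => ?_)
    · simp [cornerEquiv_succ, cornerEquiv_zero]
    · induction z with
      | _ i j => simp [cornerEquiv_succ, symMatrix]

lemma measurable_symBlocks_symm : Measurable (symBlocks k).symm :=
  (LinearMap.continuous_of_finiteDimensional (symBlocks k).symm.toLinearMap).measurable

/-- The symmetric matrix `b bᵀ`. -/
def symOuter (b : Fin k → ℝ) : Sym2 (Fin k) → ℝ :=
  Sym2.lift ⟨fun i j => b i * b j, fun _ _ => mul_comm _ _⟩

lemma measurable_symOuter : Measurable (symOuter (k := k)) := by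
  refine measurable_pi_lambda _ fun z => ?_
  induction z with
  | _ i j => exact (measurable_pi_apply i).mul (measurable_pi_apply j)

/-- The symmetric matrix with corner `σ`, rest of the first column `b`, and Schur complement `D`;
these are the coordinates in which the inverse Wishart density factorizes. -/
noncomputable def ofSchur (p : (ℝ × (Fin k → ℝ)) × (Sym2 (Fin k) → ℝ)) : Sym2 (Fin (k + 1)) → ℝ :=
  (symBlocks k).symm (p.1, p.1.1⁻¹ • symOuter p.1.2 + p.2)

lemma ofSchur_apply_zero_zero (p : (ℝ × (Fin k → ℝ)) × (Sym2 (Fin k) → ℝ)) :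
    ofSchur p s(0, 0) = p.1.1 :=
  congrArg (fun q => q.1.1) ((symBlocks k).apply_symm_apply _)

lemma symMatrix_ofSchur (σ : ℝ) (b : Fin k → ℝ) (D : Sym2 (Fin k) → ℝ) :
    symMatrix (ofSchur ((σ, b), D)) =
      (schurMatrix σ b (symMatrix D)).submatrix (cornerEquiv k) (cornerEquiv k) := by
  rw [schurMatrix, add_comm (symMatrix D)]
  rfl

lemma ofSchur_mem_posDefSet (σ : ℝ) (b : Fin k → ℝ) (D : Sym2 (Fin k) → ℝ) :
    ofSchur ((σ, b), D) ∈ posDefSet (k + 1) ↔ 0 < σ ∧ D ∈ posDefSet k := by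
  rw [posDefSet, Set.mem_ofPred_eq, symMatrix_ofSchur, posDefSet, Set.mem_ofPred_eq,
    ← posDef_schurMatrix b]
  exact ⟨fun h => by simpa using h.submatrix (cornerEquiv k).symm.injective,
    fun h => h.submatrix (cornerEquiv k).injective⟩

lemma measurable_schurShift :
    Measurable fun p : (ℝ × (Fin k → ℝ)) × (Sym2 (Fin k) → ℝ) =>
      p.1.1⁻¹ • symOuter p.1.2 + p.2 := by
  have := measurable_symOuter (k := k)
  fun_prop

lemma measurable_ofSchur : Measurable (ofSchur (k := k)) :=
  measurable_symBlocks_symm.comp (measurable_fst.prodMk measurable_schurShift)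

lemma exists_volume_eq_smul_map_ofSchur (k : ℕ) :
    ∃ c : ℝ≥0, c ≠ 0 ∧
      (volume : Measure (Sym2 (Fin (k + 1)) → ℝ)) = c • volume.map (ofSchur (k := k)) := by
  have : (volume : Measure (ℝ × (Fin k → ℝ))).IsAddHaarMeasure :=
    Measure.prod.instIsAddHaarMeasure _ _
  have : (volume : Measure ((ℝ × (Fin k → ℝ)) × (Sym2 (Fin k) → ℝ))).IsAddHaarMeasure :=
    Measure.prod.instIsAddHaarMeasure _ _
  have hshear : MeasurePreserving fun p : (ℝ × (Fin k → ℝ)) × (Sym2 (Fin k) → ℝ) =>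
      (p.1, p.1.1⁻¹ • symOuter p.1.2 + p.2) := by
    exact MeasurePreserving.skew_product (f := id)
      (g := fun (q : ℝ × (Fin k → ℝ)) D => q.1⁻¹ • symOuter q.2 + D)
      (MeasurePreserving.id volume) measurable_schurShift
      (.of_forall fun q => map_add_left_eq_self volume (q.1⁻¹ • symOuter q.2))
  obtain ⟨c, hc, hvol⟩ := exists_eq_smul_map_linearEquiv
    (volume : Measure ((ℝ × (Fin k → ℝ)) × (Sym2 (Fin k) → ℝ))) volume (symBlocks k).symm
  refine ⟨c, hc, hvol.trans ?_⟩
  nth_rewrite 1 [← hshear.map_eq]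
  rw [Measure.map_map measurable_symBlocks_symm hshear.measurable]
  rfl

lemma normalDensity_smul (μ : Fin k → ℝ) {c : ℝ} (hc : 0 < c) {S : Matrix (Fin k) (Fin k) ℝ}
    (hS : S.PosDef) (y : Fin k → ℝ) :
    normalDensity μ (c • S) y =
      (2 * Real.pi) ^ (-(k : ℝ) / 2) * c ^ (-(k : ℝ) / 2) * S.det ^ (-(1 : ℝ) / 2) *
        Real.exp (-(1 / 2) * (c⁻¹ * ((y - μ) ⬝ᵥ (S⁻¹ *ᵥ (y - μ))))) := by
  have hinv : (c • S)⁻¹ = c⁻¹ • S⁻¹ := by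
    refine Matrix.inv_eq_right_inv ?_
    rw [Matrix.smul_mul, Matrix.mul_smul, Matrix.mul_nonsing_inv _ hS.det_pos.ne'.isUnit,
      smul_smul, mul_inv_cancel₀ hc.ne', one_smul]
  rw [normalDensity, hinv, Matrix.det_smul, Fintype.card_fin,
    Real.mul_rpow (by positivity) hS.det_pos.le, ← Real.rpow_natCast, ← Real.rpow_mul hc.le,
    Matrix.smul_mulVec, dotProduct_smul, smul_eq_mul, ← mul_assoc]
  congr 4
  ring

lemma invWishartKernel_schurMatrix (m : ℝ) {σ : ℝ} (hσ : 0 < σ) (b : Fin k → ℝ)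
    {D : Matrix (Fin k) (Fin k) ℝ} (hD : D.PosDef) :
    invWishartKernel m 1 (schurMatrix σ b D) =
      (2 * Real.pi) ^ ((k : ℝ) / 2) * (σ ^ (k - m / 2) * Real.exp (-(1 / 2) * σ⁻¹)) *
        invWishartKernel (m - 1) 1 D * normalDensity 0 (σ ^ 2 • D) b := by
  have hpi : (2 * Real.pi) ^ ((k : ℝ) / 2) * (2 * Real.pi) ^ (-(k : ℝ) / 2) = 1 := by
    rw [← Real.rpow_add (by positivity)]
    simp [neg_div]
  have hσpow : σ ^ (-m / 2) = σ ^ (k - m / 2) * (σ ^ 2) ^ (-(k : ℝ) / 2) := by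
    rw [← Real.rpow_natCast, ← Real.rpow_mul hσ.le, ← Real.rpow_add hσ]
    congr 1
    push_cast
    ring
  have hDpow : D.det ^ (-m / 2) = D.det ^ (-(m - 1) / 2) * D.det ^ (-(1 : ℝ) / 2) := by
    rw [← Real.rpow_add hD.det_pos]
    congr 1
    ring
  rw [normalDensity_smul 0 (by positivity) hD, sub_zero, invWishartKernel, invWishartKernel,
    Matrix.mul_one, Matrix.mul_one, det_schurMatrix b hσ.ne',
    trace_inv_schurMatrix b hσ.ne' hD.det_pos.ne', Real.mul_rpow hσ.le hD.det_pos.le, hσpow, hDpow,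
    mul_add, mul_add, Real.exp_add, Real.exp_add, inv_pow]
  linear_combination (-(σ ^ (k - m / 2) * (σ ^ 2) ^ (-(k : ℝ) / 2) *
    (D.det ^ (-(m - 1) / 2) * D.det ^ (-(1 : ℝ) / 2)) *
    (Real.exp (-(1 / 2) * σ⁻¹) * Real.exp (-(1 / 2) * ((σ ^ 2)⁻¹ * (b ⬝ᵥ (D⁻¹ *ᵥ b)))) *
      Real.exp (-(1 / 2) * D⁻¹.trace)))) * hpi

end SchurCoordinates

section InverseGamma

lemma map_inv_gammaMeasure (a r : ℝ) :
    (gammaMeasure a r).map (·⁻¹) = volume.withDensity ((Set.Ioi 0).indicator fun σ =>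
      ENNReal.ofReal (r ^ a / Real.Gamma a * (σ ^ (-a - 1) * Real.exp (-r * σ⁻¹)))) := by
  ext s hs
  have hsub : ∀ᵐ u : ℝ, u ∈ (·⁻¹) ⁻¹' s → gammaPDF a r u =
      (Set.Ioi 0).indicator (gammaPDF a r) u := by
    filter_upwards [Measure.ae_ne volume (0 : ℝ)] with u hu _
    rcases hu.lt_or_gt with h | h
    · rw [gammaPDF_of_neg h, Set.indicator_of_notMem (by simpa using h.le)]
    · rw [Set.indicator_of_mem (Set.mem_Ioi.mpr h)]
  have himg : (·⁻¹) '' (Set.Ioi (0 : ℝ) ∩ (·⁻¹) ⁻¹' s) = Set.Ioi 0 ∩ s := by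
    ext x
    simp [Set.image_inv_eq_inv]
  rw [Measure.map_apply measurable_inv hs, gammaMeasure, withDensity_apply _ (measurable_inv hs),
    withDensity_apply _ hs, setLIntegral_congr_fun_ae (measurable_inv hs) hsub,
    setLIntegral_indicator measurableSet_Ioi, setLIntegral_indicator measurableSet_Ioi, ← himg,
    lintegral_image_eq_lintegral_abs_deriv_mul (measurableSet_Ioi.inter (measurable_inv hs))
      (f' := fun u => -(u ^ 2)⁻¹) (fun u hu => (hasDerivAt_inv (ne_of_gt hu.1)).hasDerivWithinAt)
      inv_injective.injOn]
  refine setLIntegral_congr_fun (measurableSet_Ioi.inter (measurable_inv hs)) fun u hu => ?_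
  have hu : 0 < u := hu.1
  have hpow : u ^ (a - 1) = (u ^ 2)⁻¹ * u⁻¹ ^ (-a - 1) := by
    rw [Real.inv_rpow hu.le, ← Real.rpow_neg hu.le, ← Real.rpow_natCast, ← Real.rpow_neg hu.le,
      ← Real.rpow_add hu]
    congr 1
    push_cast
    ring
  rw [gammaPDF_of_nonneg hu.le, ← ENNReal.ofReal_mul (abs_nonneg _), abs_neg,
    abs_of_pos (by positivity), inv_inv, hpow, neg_mul]
  congr 1
  ring

end InverseGamma

section InverseWishartMarginals

variable {k : ℕ}

lemma lintegral_normalDensity (μ : Fin k → ℝ) {S : Matrix (Fin k) (Fin k) ℝ} (hS : S.PosDef) :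
    ∫⁻ y, ENNReal.ofReal (normalDensity μ S y) = 1 := by
  have := isProbabilityMeasure_normalLaw μ hS
  simpa [normalLaw] using measure_univ (μ := normalLaw μ S)

lemma lintegral_invWishartKernel_ofSchur (m σ : ℝ) (D : Sym2 (Fin k) → ℝ) :
    ∫⁻ b, (posDefSet (k + 1)).indicator
        (fun s => ENNReal.ofReal (invWishartKernel m 1 (symMatrix s))) (ofSchur ((σ, b), D)) =
      (Set.Ioi 0).indicator (fun σ => ENNReal.ofReal ((2 * Real.pi) ^ ((k : ℝ) / 2) *
          (σ ^ (k - m / 2) * Real.exp (-(1 / 2) * σ⁻¹)))) σ *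
        (posDefSet k).indicator
          (fun s => ENNReal.ofReal (invWishartKernel (m - 1) 1 (symMatrix s))) D := by
  by_cases h : 0 < σ ∧ D ∈ posDefSet k
  · obtain ⟨hσ, hD⟩ := h
    have hpd : (σ ^ 2 • symMatrix D).PosDef := Matrix.PosDef.smul hD (by positivity)
    have hpos := invWishartKernel_pos (m - 1) 1 hD
    rw [Set.indicator_of_mem (Set.mem_Ioi.mpr hσ), Set.indicator_of_mem hD,
      ← ENNReal.ofReal_mul (by positivity), ← mul_one (ENNReal.ofReal _),
      ← lintegral_normalDensity 0 hpd, ← lintegral_const_mul' _ _ ENNReal.ofReal_ne_top]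
    refine lintegral_congr fun b => ?_
    rw [Set.indicator_of_mem ((ofSchur_mem_posDefSet σ b D).mpr ⟨hσ, hD⟩), symMatrix_ofSchur,
      invWishartKernel_one_submatrix, invWishartKernel_schurMatrix m hσ b hD,
      ENNReal.ofReal_mul (by positivity)]
  · have hnot : ∀ b, ofSchur ((σ, b), D) ∉ posDefSet (k + 1) := fun b =>
      mt (ofSchur_mem_posDefSet σ b D).mp h
    simp only [Set.indicator_of_notMem (hnot _), lintegral_zero]
    rcases not_and_or.mp h with hσ | hD
    · rw [Set.indicator_of_notMem (by simpa using hσ), zero_mul]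
    · rw [Set.indicator_of_notMem hD, mul_zero]

lemma exists_map_corner_invWishartMeasure_one (k : ℕ) (m : ℝ) :
    ∃ c : ℝ≥0, c ≠ 0 ∧ (invWishartMeasure (k := k + 1) m 1).map (fun s => s s(0, 0)) =
      (c * invWishartMeasure (k := k) (m - 1) 1 Set.univ) • volume.withDensity
        ((Set.Ioi 0).indicator fun σ => ENNReal.ofReal ((2 * Real.pi) ^ ((k : ℝ) / 2) *
          (σ ^ (k - m / 2) * Real.exp (-(1 / 2) * σ⁻¹)))) := by
  obtain ⟨c, hc, hvol⟩ := exists_volume_eq_smul_map_ofSchur k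
  refine ⟨c, hc, ?_⟩
  set w := (posDefSet (k + 1)).indicator
    fun s => ENNReal.ofReal (invWishartKernel m 1 (symMatrix s)) with hw
  have hwm : Measurable w := measurable_indicator_invWishartKernel m 1
  have hwo : Measurable (w ∘ ofSchur) := hwm.comp measurable_ofSchur
  have hmap : ((volume.withDensity (w ∘ ofSchur)).map ofSchur).map (fun s => s s(0, 0)) =
      volume.withDensity fun σ => ∫⁻ b, ∫⁻ D, w (ofSchur ((σ, b), D)) := by
    have hcorner : (fun s : Sym2 (Fin (k + 1)) → ℝ => s s(0, 0)) ∘ ofSchur =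
        Prod.fst ∘ Prod.fst := funext ofSchur_apply_zero_zero
    rw [Measure.map_map (measurable_pi_apply _) measurable_ofSchur, hcorner,
      ← Measure.map_map measurable_fst measurable_fst]
    change Measure.map Prod.fst (Measure.map Prod.fst ((volume.prod volume).withDensity _)) = _
    rw [map_fst_prod_withDensity _ _ hwo]
    exact map_fst_prod_withDensity _ _ hwo.lintegral_prod_right'
  have hinner : (fun σ => ∫⁻ b, ∫⁻ D, w (ofSchur ((σ, b), D))) =
      invWishartMeasure (k := k) (m - 1) 1 Set.univ •
        (Set.Ioi 0).indicator fun σ => ENNReal.ofReal ((2 * Real.pi) ^ ((k : ℝ) / 2) *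
          (σ ^ (k - m / 2) * Real.exp (-(1 / 2) * σ⁻¹))) := by
    ext σ
    rw [lintegral_lintegral_swap (f := fun b D => w (ofSchur ((σ, b), D)))
      (hwo.comp (by fun_prop : Measurable fun p : (Fin k → ℝ) × (Sym2 (Fin k) → ℝ) =>
        ((σ, p.1), p.2))).aemeasurable]
    simp only [w, lintegral_invWishartKernel_ofSchur]
    rw [lintegral_const_mul _ (measurable_indicator_invWishartKernel _ 1), mul_comm,
      invWishartMeasure_eq_withDensity_indicator, withDensity_apply _ MeasurableSet.univ,
      Measure.restrict_univ]
    rfl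
  rw [invWishartMeasure_eq_withDensity_indicator, ← hw, hvol]
  change Measure.map _ (((c : ℝ≥0∞) • volume.map ofSchur).withDensity w) = _
  rw [withDensity_smul_measure, Measure.map_smul, ← map_withDensity_comp _ measurable_ofSchur hwm,
    hmap, hinner, withDensity_smul _ (Measurable.indicator (by fun_prop) measurableSet_Ioi),
    smul_smul]

lemma exists_map_corner_invWishartMeasure_one_eq_gammaMeasure {m : ℝ}
    (hm : 2 * ((k + 1 : ℕ) : ℝ) < m) :
    ∃ c : ℝ≥0, c ≠ 0 ∧ (invWishartMeasure (k := k + 1) m 1).map (fun s => s s(0, 0)) =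
      (c * invWishartMeasure (k := k) (m - 1) 1 Set.univ) •
        (gammaMeasure ((m - 2 * (k + 1 : ℕ)) / 2) (1 / 2)).map (·⁻¹) := by
  obtain ⟨c, hc, hmap⟩ := exists_map_corner_invWishartMeasure_one k m
  set a := (m - 2 * (k + 1 : ℕ)) / 2 with ha
  set K := (1 / 2 : ℝ) ^ a / Real.Gamma a
  have hapos : 0 < a := by linarith
  have hKpos : 0 < K := div_pos (by positivity) (Real.Gamma_pos_of_pos hapos)
  have hexp : (k : ℝ) - m / 2 = -a - 1 := by
    rw [ha]
    push_cast
    ring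
  have hdens : ((Set.Ioi 0).indicator fun σ => ENNReal.ofReal ((2 * Real.pi) ^ ((k : ℝ) / 2) *
        (σ ^ (k - m / 2) * Real.exp (-(1 / 2) * σ⁻¹)))) =
      ENNReal.ofReal ((2 * Real.pi) ^ ((k : ℝ) / 2) / K) • (Set.Ioi 0).indicator fun σ =>
        ENNReal.ofReal (K * (σ ^ (-a - 1) * Real.exp (-(1 / 2) * σ⁻¹))) := by
    ext σ
    rw [Pi.smul_apply, smul_eq_mul, ← Set.indicator_const_mul, hexp]
    refine congrArg (fun f => (Set.Ioi 0).indicator f σ) (funext fun σ => ?_)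
    rw [← ENNReal.ofReal_mul (by positivity), ← mul_assoc (_ / K), div_mul_cancel₀ _ hKpos.ne']
  refine ⟨c * ((2 * Real.pi) ^ ((k : ℝ) / 2) / K).toNNReal,
    mul_ne_zero hc (Real.toNNReal_pos.mpr (by positivity)).ne', ?_⟩
  rw [hmap, hdens, withDensity_smul _ (Measurable.indicator (by fun_prop) measurableSet_Ioi),
    ← map_inv_gammaMeasure, smul_smul, ENNReal.coe_mul]
  congr 1
  exact mul_right_comm _ _ _

lemma invWishartMeasure_one_univ (k : ℕ) {m : ℝ} (hm : 2 * (k : ℝ) < m) :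
    invWishartMeasure (k := k) m 1 Set.univ ≠ 0 ∧ invWishartMeasure (k := k) m 1 Set.univ ≠ ∞ := by
  induction k generalizing m with
  | zero =>
    have huniv : posDefSet 0 = Set.univ :=
      Set.eq_univ_of_forall fun s => by
        rw [posDefSet, Set.mem_ofPred_eq, Subsingleton.elim (symMatrix s) 1]
        exact Matrix.PosDef.one
    simp [invWishartMeasure, huniv, invWishartKernel, volume_pi, Matrix.trace]
  | succ k ih =>
    obtain ⟨c, hc, hmap⟩ := exists_map_corner_invWishartMeasure_one_eq_gammaMeasure hm
    obtain ⟨hne_zero, hne_top⟩ := ih (m := m - 1) (by push_cast at hm; linarith)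
    have := isProbabilityMeasure_gammaMeasure (a := (m - 2 * (k + 1 : ℕ)) / 2) (r := 1 / 2)
      (by linarith) (by norm_num)
    have huniv := congrArg (· Set.univ) hmap
    simp only [Measure.smul_apply, Measure.map_apply (measurable_pi_apply _) MeasurableSet.univ,
      Measure.map_apply measurable_inv MeasurableSet.univ, Set.preimage_univ, measure_univ,
      smul_eq_mul, mul_one] at huniv
    rw [huniv]
    exact ⟨mul_ne_zero (by exact_mod_cast hc) hne_zero, ENNReal.mul_ne_top (by simp) hne_top⟩

lemma invWishartMeasure_univ {m : ℝ} (hm : 2 * (k : ℝ) < m) {S : Matrix (Fin k) (Fin k) ℝ}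
    (hS : S.PosDef) :
    invWishartMeasure m S Set.univ ≠ 0 ∧ invWishartMeasure m S Set.univ ≠ ∞ := by
  obtain ⟨A, hA, rfl⟩ := exists_mul_transpose_eq hS
  obtain ⟨c, hc, hmap⟩ := exists_invWishartMeasure_eq_smul_map_symConj m 1 hA
  obtain ⟨hne_zero, hne_top⟩ := invWishartMeasure_one_univ k hm
  rw [Matrix.mul_one] at hmap
  rw [hmap, Measure.smul_apply, Measure.map_apply (measurable_symConj A) MeasurableSet.univ,
    Set.preimage_univ]
  exact ⟨smul_ne_zero hc hne_zero, ENNReal.nnreal_smul_ne_top hne_top⟩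

lemma quadForm_symConj {A : Matrix (Fin k) (Fin k) ℝ} {v : Fin k → ℝ} {i : Fin k} {q : ℝ}
    (hv : v ᵥ* A = Pi.single i q) (s : Sym2 (Fin k) → ℝ) :
    v ⬝ᵥ (symMatrix (symConj A s) *ᵥ v) = q ^ 2 * s s(i, i) := by
  rw [symMatrix_symConj, Matrix.mul_assoc, ← Matrix.mulVec_mulVec, Matrix.dotProduct_mulVec, hv,
    ← Matrix.mulVec_mulVec, Matrix.mulVec_transpose, hv, single_dotProduct, Matrix.mulVec_single]
  simp [symMatrix]
  ring

lemma measurable_quadForm (v : Fin k → ℝ) :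
    Measurable fun s : Sym2 (Fin k) → ℝ => v ⬝ᵥ (symMatrix s *ᵥ v) :=
  (continuous_const.dotProduct (continuous_symMatrix.matrix_mulVec continuous_const)).measurable

lemma exists_map_quadForm_invWishartMeasure {m : ℝ} (hm : 2 * (k : ℝ) < m)
    {S : Matrix (Fin k) (Fin k) ℝ} (hS : S.PosDef) (v : Fin k → ℝ) :
    ∃ c : ℝ≥0∞, (invWishartMeasure m S).map (fun s => v ⬝ᵥ (symMatrix s *ᵥ v)) =
      c • (gammaMeasure ((m - 2 * k) / 2) (1 / 2)).map (fun u => v ⬝ᵥ (S *ᵥ v) / u) := by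
  have hprob := isProbabilityMeasure_gammaMeasure (a := (m - 2 * k) / 2) (r := 1 / 2)
    (by linarith) (by norm_num)
  cases k with
  | zero =>
    refine ⟨invWishartMeasure m S Set.univ, ?_⟩
    simp only [Subsingleton.elim v 0, zero_dotProduct, zero_div, Measure.map_const, measure_univ,
      one_smul]
  | succ k =>
    obtain ⟨A, hA, rfl, hv⟩ := exists_mul_transpose_eq_and_vecMul_eq_single hS 0 v
    set Q := v ⬝ᵥ ((A * Aᵀ) *ᵥ v)
    have hQ : √Q ^ 2 = Q :=
      Real.sq_sqrt (by simpa using hS.posSemidef.dotProduct_mulVec_nonneg v)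
    obtain ⟨c, -, hconj⟩ := exists_invWishartMeasure_eq_smul_map_symConj m 1 hA
    obtain ⟨c', -, hcorner⟩ := exists_map_corner_invWishartMeasure_one_eq_gammaMeasure hm
    rw [Matrix.mul_one] at hconj
    refine ⟨c * (c' * invWishartMeasure (k := k) (m - 1) 1 Set.univ), ?_⟩
    have hquad : (fun s => v ⬝ᵥ (symMatrix s *ᵥ v)) ∘ symConj A =
        (Q * ·) ∘ fun s => s s(0, 0) := by
      ext s
      simp only [Function.comp_apply, quadForm_symConj hv, hQ]
    have hmul : Measurable (Q * ·) := measurable_const_mul Q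
    change Measure.map _ (invWishartMeasure m (A * Aᵀ)) = _
    rw [hconj, Measure.map_smul, Measure.map_map (measurable_quadForm v) (measurable_symConj A),
      hquad, ← Measure.map_map hmul (measurable_pi_apply _), hcorner, Measure.map_smul,
      Measure.map_map hmul measurable_inv]
    simp only [Function.comp_def, ← div_eq_mul_inv]
    exact smul_smul (c : ℝ≥0∞) _ _

lemma map_quadForm_invWishartMeasure {m : ℝ} (hm : 2 * (k : ℝ) < m)
    {S : Matrix (Fin k) (Fin k) ℝ} (hS : S.PosDef) (v : Fin k → ℝ) :
    (invWishartMeasure m S).map (fun s => v ⬝ᵥ (symMatrix s *ᵥ v)) =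
      invWishartMeasure m S Set.univ •
        (gammaMeasure ((m - 2 * k) / 2) (1 / 2)).map (fun u => v ⬝ᵥ (S *ᵥ v) / u) := by
  have hprob := isProbabilityMeasure_gammaMeasure (a := (m - 2 * k) / 2) (r := 1 / 2)
    (by linarith) (by norm_num)
  obtain ⟨c, hc⟩ := exists_map_quadForm_invWishartMeasure hm hS v
  have hdiv : Measurable fun u : ℝ => v ⬝ᵥ (S *ᵥ v) / u := by fun_prop
  have hmass := congrArg (· Set.univ) hc
  simp only [Measure.smul_apply, Measure.map_apply (measurable_quadForm v) MeasurableSet.univ,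
    Measure.map_apply hdiv MeasurableSet.univ,
    Set.preimage_univ, measure_univ, smul_eq_mul, mul_one] at hmass
  rw [hc, hmass]

end InverseWishartMarginals

section Student

lemma lintegral_comp_const_mul {f : ℝ → ℝ≥0∞} (hf : Measurable f) {a : ℝ} (ha : 0 < a) :
    ENNReal.ofReal a * ∫⁻ x, f (a * x) = ∫⁻ x, f x := by
  nth_rewrite 2 [← Real.smul_map_volume_mul_left ha.ne']
  rw [lintegral_smul_measure, lintegral_map hf (measurable_const_mul a), abs_of_pos ha, smul_eq_mul]

/-- The density at `t` of `Y / √V` for independent `Y ∼ N(0, 1)` and `V ∼ Gamma(a, 1 / 2)`; this is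
the law `t_{2a}` scaled by `1 / √(2a)`. -/
noncomputable def scaledStudentPDF (a t : ℝ) : ℝ≥0∞ :=
  ENNReal.ofReal (Real.Gamma (a + 1 / 2) / (√Real.pi * Real.Gamma a) *
    (1 + t ^ 2) ^ (-(a + 1 / 2)))

lemma measurable_scaledStudentPDF (a : ℝ) : Measurable (scaledStudentPDF a) := by
  unfold scaledStudentPDF
  fun_prop

lemma gammaPDF_mul_gaussianPDF {a : ℝ} (ha : 0 < a) {v : ℝ} (hv : 0 < v) (t : ℝ) :
    gammaPDF a (1 / 2) v * gaussianPDF 0 v⁻¹.toNNReal t =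
      ENNReal.ofReal (1 + t ^ 2) * (scaledStudentPDF a t *
        gammaPDF (a + 1 / 2) (1 / 2) ((1 + t ^ 2) * v)) := by
  have hq : 0 < 1 + t ^ 2 := by positivity
  have hq_pow : (1 + t ^ 2) ^ (-(a + 1 / 2)) = ((1 + t ^ 2) * (1 + t ^ 2) ^ (a - 1 / 2))⁻¹ := by
    rw [Real.rpow_neg hq.le, show a + 1 / 2 = 1 + (a - 1 / 2) by ring, Real.rpow_add hq,
      Real.rpow_one]
  have hv_pow : v ^ (a - 1 / 2) = v ^ (a - 1) * √v := by
    rw [Real.sqrt_eq_rpow, ← Real.rpow_add hv]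
    ring_nf
  have hhalf : (1 / 2 : ℝ) ^ (a + 1 / 2) = (1 / 2) ^ a / √2 := by
    rw [Real.rpow_add (by norm_num), ← Real.sqrt_eq_rpow, Real.sqrt_div one_pos.le, Real.sqrt_one,
      mul_one_div]
  have hexp : Real.exp (-(1 / 2 * v)) * Real.exp (-t ^ 2 / (2 * v⁻¹)) =
      Real.exp (-(1 / 2 * ((1 + t ^ 2) * v))) := by
    rw [← Real.exp_add]
    congr 1
    field_simp
    ring
  rw [gammaPDF_of_nonneg hv.le, gammaPDF_of_nonneg (mul_pos hq hv).le, gaussianPDF, gaussianPDFReal,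
    scaledStudentPDF, Real.coe_toNNReal _ (inv_pos.mpr hv).le, sub_zero,
    ← ENNReal.ofReal_mul (by positivity), ← ENNReal.ofReal_mul (by positivity),
    ← ENNReal.ofReal_mul hq.le, ← hexp, show a + 1 / 2 - 1 = a - 1 / 2 by ring,
    Real.mul_rpow hq.le hv.le, hv_pow, hhalf, hq_pow, ← div_eq_mul_inv, Real.sqrt_div' _ hv.le,
    Real.sqrt_mul two_pos.le]
  congr 1
  field_simp

lemma lintegral_gaussianReal_div_sqrt {v : ℝ} (hv : 0 < v) {g : ℝ → ℝ → ℝ≥0∞}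
    (hg : Measurable (Function.uncurry g)) :
    ∫⁻ y, g (y / √v) (v + y ^ 2) ∂(gaussianReal 0 1) =
      ∫⁻ t, gaussianPDF 0 v⁻¹.toNNReal t * g t ((1 + t ^ 2) * v) := by
  have hvar : v⁻¹.toNNReal ≠ 0 := (Real.toNNReal_pos.mpr (inv_pos.mpr hv)).ne'
  have hmap : (gaussianReal 0 1).map (· / √v) = gaussianReal 0 v⁻¹.toNNReal := by
    rw [gaussianReal_map_div_const, zero_div]
    congr 1
    ext
    simp [Real.sq_sqrt hv.le, hv.le]
  have hgv : Measurable fun t => g t ((1 + t ^ 2) * v) := by fun_prop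
  change _ = ∫⁻ t, (gaussianPDF 0 v⁻¹.toNNReal * fun t => g t ((1 + t ^ 2) * v)) t
  rw [← lintegral_withDensity_eq_lintegral_mul _ (measurable_gaussianPDF _ _) hgv,
    ← gaussianReal_of_var_ne_zero 0 hvar, ← hmap, lintegral_map hgv (by fun_prop)]
  refine lintegral_congr fun y => ?_
  rw [div_pow, Real.sq_sqrt hv.le]
  congr 1
  field_simp

lemma gammaPDF_mul_lintegral_gaussianReal {a : ℝ} (ha : 0 < a) {v : ℝ} (hv : v ≠ 0)
    {g : ℝ × ℝ → ℝ≥0∞} (hg : Measurable g) :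
    gammaPDF a (1 / 2) v * ∫⁻ y, g (y / √v, v + y ^ 2) ∂(gaussianReal 0 1) =
      ∫⁻ t, ENNReal.ofReal (1 + t ^ 2) * (scaledStudentPDF a t *
        (gammaPDF (a + 1 / 2) (1 / 2) ((1 + t ^ 2) * v) * g (t, (1 + t ^ 2) * v))) := by
  rcases hv.lt_or_gt with hv | hv
  · have hneg : ∀ t : ℝ, (1 + t ^ 2) * v < 0 := fun t =>
      mul_neg_of_pos_of_neg (by positivity) hv
    simp [gammaPDF_of_neg hv, gammaPDF_of_neg (hneg _)]
  · rw [lintegral_gaussianReal_div_sqrt hv (g := fun t u => g (t, u)) hg,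
      ← lintegral_const_mul' (gammaPDF a (1 / 2) v) _ ENNReal.ofReal_ne_top]
    refine lintegral_congr fun t => ?_
    rw [← mul_assoc, gammaPDF_mul_gaussianPDF ha hv]
    simp only [mul_assoc]

-- Given `t = y / √v`, the variable `v` is again gamma distributed, and its rescaling
-- `v (1 + t²) = v + y²` has a law that does not depend on `t`.
lemma map_gaussianReal_prod_gammaMeasure_eq_withDensity {a : ℝ} (ha : 0 < a) :
    ((gaussianReal 0 1).prod (gammaMeasure a (1 / 2))).map
        (fun p => (p.1 / √p.2, p.2 + p.1 ^ 2)) =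
      (volume.withDensity (scaledStudentPDF a)).prod (gammaMeasure (a + 1 / 2) (1 / 2)) := by
  have hγ := isProbabilityMeasure_gammaMeasure ha (r := 1 / 2) (by norm_num)
  have hγ' := isProbabilityMeasure_gammaMeasure (a := a + 1 / 2) (r := 1 / 2) (by linarith)
    (by norm_num)
  have hpdf : ∀ b, Measurable (gammaPDF b (1 / 2)) := fun b =>
    (measurable_gammaPDFReal b _).ennreal_ofReal
  have hρ := measurable_scaledStudentPDF a
  refine Measure.ext_of_lintegral _ fun g hg => ?_
  let f : ℝ → ℝ → ℝ≥0∞ := fun t v => scaledStudentPDF a t *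
    (gammaPDF (a + 1 / 2) (1 / 2) v * g (t, v))
  have hf : ∀ t, Measurable (f t) := fun t => by fun_prop
  have hinner : ∀ᵐ v, gammaPDF a (1 / 2) v * ∫⁻ y, g (y / √v, v + y ^ 2) ∂(gaussianReal 0 1) =
      ∫⁻ t, ENNReal.ofReal (1 + t ^ 2) * f t ((1 + t ^ 2) * v) := by
    filter_upwards [Measure.ae_ne volume (0 : ℝ)] with v hv
    exact gammaPDF_mul_lintegral_gaussianReal ha hv hg
  calc ∫⁻ p, g p ∂(Measure.map (fun p => (p.1 / √p.2, p.2 + p.1 ^ 2))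
        ((gaussianReal 0 1).prod (gammaMeasure a (1 / 2))))
      = ∫⁻ v, gammaPDF a (1 / 2) v * ∫⁻ y, g (y / √v, v + y ^ 2) ∂(gaussianReal 0 1) := by
        rw [lintegral_map hg (by fun_prop), lintegral_prod_symm _ (by fun_prop), gammaMeasure,
          lintegral_withDensity_eq_lintegral_mul _ (hpdf a)
            (Measurable.lintegral_prod_left (by fun_prop))]
        rfl
    _ = ∫⁻ t, ∫⁻ v, ENNReal.ofReal (1 + t ^ 2) * f t ((1 + t ^ 2) * v) := by
        rw [lintegral_congr_ae hinner, lintegral_lintegral_swap (by fun_prop)]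
    _ = ∫⁻ t, ∫⁻ v, f t v := by
        refine lintegral_congr fun t => ?_
        rw [lintegral_const_mul' _ _ ENNReal.ofReal_ne_top,
          lintegral_comp_const_mul (hf t) (by positivity)]
    _ = ∫⁻ p, g p ∂((volume.withDensity (scaledStudentPDF a)).prod
          (gammaMeasure (a + 1 / 2) (1 / 2))) := by
        rw [lintegral_prod _ hg.aemeasurable, lintegral_withDensity_eq_lintegral_mul _ hρ
          hg.lintegral_prod_right']
        refine lintegral_congr fun t => ?_
        have hgt : Measurable fun u => g (t, u) := by fun_prop
        rw [Pi.mul_apply, gammaMeasure, lintegral_withDensity_eq_lintegral_mul _ (hpdf _) hgt]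
        exact lintegral_const_mul _ ((hpdf _).mul hgt)

lemma map_gaussianReal_prod_gammaMeasure {a : ℝ} (ha : 0 < a) :
    ((gaussianReal 0 1).prod (gammaMeasure a (1 / 2))).map
        (fun p => (p.1 / √p.2, p.2 + p.1 ^ 2)) =
      (((gaussianReal 0 1).prod (gammaMeasure a (1 / 2))).map (fun p => p.1 / √p.2)).prod
        (gammaMeasure (a + 1 / 2) (1 / 2)) := by
  have hγ' := isProbabilityMeasure_gammaMeasure (a := a + 1 / 2) (r := 1 / 2) (by linarith)
    (by norm_num)
  have hmap := map_gaussianReal_prod_gammaMeasure_eq_withDensity ha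
  have hfst := congrArg (Measure.map Prod.fst) hmap
  rw [Measure.map_map measurable_fst (by fun_prop), Measure.map_fst_prod, measure_univ,
    one_smul] at hfst
  rw [hmap, ← hfst]
  rfl

lemma map_div_sqrt_eq_map_studentT {d : ℝ} (hd : 0 < d) :
    ((gaussianReal 0 1).prod (gammaMeasure (d / 2) (1 / 2))).map (fun p => p.1 / √p.2) =
      (studentT d).map (· / √d) := by
  rw [studentT, Measure.map_map (by fun_prop) (by fun_prop)]
  congr 1
  ext p
  simp only [Function.comp_apply]
  rw [div_div, Real.sqrt_div' _ hd.le, div_mul_cancel₀ _ (Real.sqrt_pos.mpr hd).ne']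

lemma isProbabilityMeasure_studentT {d : ℝ} (hd : 0 < d) :
    IsProbabilityMeasure (studentT d) := by
  have := isProbabilityMeasure_gammaMeasure (half_pos hd) (r := 1 / 2) (by norm_num)
  exact Measure.isProbabilityMeasure_map (by fun_prop)

/-- The joint law of `(Y / √V, Z / √V)` for independent `Y, Z ∼ N(0, 1)` and `V ∼ χ²_d`. -/
noncomputable def studentPair (d : ℝ) : Measure (ℝ × ℝ) :=
  (((gaussianReal 0 1).prod (gammaMeasure (d / 2) (1 / 2))).prod (gaussianReal 0 1)).map
    fun p => (p.1.1 / √p.1.2, p.2 / √p.1.2)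

lemma ae_pos_gammaMeasure (a r : ℝ) : ∀ᵐ u ∂(gammaMeasure a r), 0 < u := by
  have hpdf : Measurable (gammaPDF a r) := (measurable_gammaPDFReal a r).ennreal_ofReal
  rw [gammaMeasure, ae_withDensity_iff hpdf]
  filter_upwards [Measure.ae_ne volume (0 : ℝ)] with u hu hne
  exact hu.lt_or_gt.resolve_left fun h => hne (gammaPDF_of_neg h)

lemma div_sqrt_eq_sqrt_mul_div_sqrt {v : ℝ} (hv : 0 < v) (y z : ℝ) :
    z / √v = √(1 + (y / √v) ^ 2) * (z / √(v + y ^ 2)) := by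
  have hpos : 0 < 1 + (y / √v) ^ 2 := by positivity
  have hsum : v + y ^ 2 = (1 + (y / √v) ^ 2) * v := by
    rw [div_pow, Real.sq_sqrt hv.le]
    field_simp
  rw [hsum, Real.sqrt_mul hpos.le, ← mul_div_assoc,
    mul_div_mul_left _ _ (Real.sqrt_pos.mpr hpos).ne']

-- The pair `(T, U) = (Y / √V, V + Y²)` has independent components, and
-- `Z / √V = √(1 + T²) * (Z / √U)`.
lemma studentPair_eq_map_prod_gammaMeasure {d : ℝ} (hd : 0 < d) :
    studentPair d = ((((studentT d).map (· / √d)).prod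
        (gammaMeasure ((d + 1) / 2) (1 / 2))).prod (gaussianReal 0 1)).map
      fun q => (q.1.1, √(1 + q.1.1 ^ 2) * (q.2 / √q.1.2)) := by
  have hγ := isProbabilityMeasure_gammaMeasure (half_pos hd) (r := 1 / 2) (by norm_num)
  have hpos : ∀ᵐ p ∂((gaussianReal 0 1).prod (gammaMeasure (d / 2) (1 / 2))).prod
      (gaussianReal 0 1), 0 < p.1.2 :=
    Measure.quasiMeasurePreserving_fst.ae
      (Measure.quasiMeasurePreserving_snd.ae (ae_pos_gammaMeasure _ _))
  have hmap := map_gaussianReal_prod_gammaMeasure (half_pos hd)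
  rw [map_div_sqrt_eq_map_studentT hd, show d / 2 + 1 / 2 = (d + 1) / 2 by ring] at hmap
  rw [studentPair, ← hmap]
  nth_rewrite 4 [← Measure.map_id (μ := gaussianReal 0 1)]
  rw [Measure.map_prod_map _ _ (by fun_prop) measurable_id,
    Measure.map_map (by fun_prop) (by fun_prop)]
  refine Measure.map_congr ?_
  filter_upwards [hpos] with p hp
  exact congrArg (Prod.mk _) (div_sqrt_eq_sqrt_mul_div_sqrt hp p.1.1 p.2)

lemma studentPair_eq_map_prod {d : ℝ} (hd : 0 < d) :
    studentPair d = ((studentT d).prod (studentT (d + 1))).map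
      fun p => (p.1 / √d, √(1 + p.1 ^ 2 / d) * (p.2 / √(d + 1))) := by
  have hd' : 0 < d + 1 := by linarith
  have := isProbabilityMeasure_studentT hd
  have := isProbabilityMeasure_studentT hd'
  have hγ := isProbabilityMeasure_gammaMeasure (half_pos hd') (r := 1 / 2) (by norm_num)
  have hscaled : ((gammaMeasure ((d + 1) / 2) (1 / 2)).prod (gaussianReal 0 1)).map
      (fun p => p.2 / √p.1) = (studentT (d + 1)).map (· / √(d + 1)) := by
    rw [← map_div_sqrt_eq_map_studentT hd', ← Measure.prod_swap,
      Measure.map_map (by fun_prop) measurable_swap]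
    rfl
  have hprod : ((((studentT d).map (· / √d)).prod (gammaMeasure ((d + 1) / 2) (1 / 2))).prod
      (gaussianReal 0 1)).map (fun q => (q.1.1, q.2 / √q.1.2)) =
      ((studentT d).prod (studentT (d + 1))).map (Prod.map (· / √d) (· / √(d + 1))) := by
    rw [← Measure.map_prod_map _ _ (by fun_prop) (by fun_prop), ← hscaled]
    nth_rewrite 2 [← Measure.map_id (μ := (studentT d).map (· / √d))]
    rw [Measure.map_prod_map _ _ measurable_id (by fun_prop), ← Measure.prodAssoc_prod,
      Measure.map_map (by fun_prop) (by fun_prop)]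
    rfl
  have hscale : Measurable fun p : ℝ × ℝ => (p.1, √(1 + p.1 ^ 2) * p.2) := by fun_prop
  rw [studentPair_eq_map_prod_gammaMeasure hd]
  have := congrArg (Measure.map fun p : ℝ × ℝ => (p.1, √(1 + p.1 ^ 2) * p.2)) hprod
  rw [Measure.map_map hscale (by fun_prop), Measure.map_map hscale (by fun_prop)] at this
  refine this.trans (congrArg (Measure.map · _) (funext fun p => ?_))
  simp only [Function.comp_apply, Prod.map, div_pow, Real.sq_sqrt hd.le]

end Student

section NormalInverseWishart

variable {k : ℕ}

/-- The unnormalized normal-inverse-Wishart distribution: `Σ` has the inverse Wishart density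
`invWishartKernel m S` and, given `Σ`, `μ` is normal with mean `c` and covariance `Σ / r`.
Both posteriors belong to this family. -/
noncomputable def normalInvWishart (c : Fin k → ℝ) (r m : ℝ) (S : Matrix (Fin k) (Fin k) ℝ) :
    Measure (Param k) :=
  (volume.restrict {θ : Param k | (symMatrix θ.2).PosDef}).withDensity fun θ => ENNReal.ofReal
    (invWishartKernel m S (symMatrix θ.2) * normalDensity c (r⁻¹ • symMatrix θ.2) θ.1)

lemma measurable_normalDensity_inv_smul_symMatrix (c : Fin k → ℝ) (r : ℝ) :
    Measurable fun θ : Param k => normalDensity c (r⁻¹ • symMatrix θ.2) θ.1 :=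
  measurable_normalDensity.comp (g := fun p : Param k × (Fin k → ℝ) =>
      normalDensity p.1.1 (symMatrix p.1.2) p.2)
    (f := fun θ : Param k => ((c, r⁻¹ • θ.2), θ.1)) (by fun_prop)

lemma volume_restrict_posDef_symMatrix_snd :
    (volume : Measure (Param k)).restrict {θ : Param k | (symMatrix θ.2).PosDef} =
      volume.prod (volume.restrict (posDefSet k)) := by
  rw [← Measure.restrict_univ (μ := (volume : Measure (Fin k → ℝ))), Measure.prod_restrict,
    Measure.volume_eq_prod, Set.univ_prod]
  rfl

lemma lintegral_normalInvWishart (c : Fin k → ℝ) (r m : ℝ) (S : Matrix (Fin k) (Fin k) ℝ)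
    {H : Param k → ℝ≥0∞} (hH : Measurable H) :
    ∫⁻ θ, H θ ∂(normalInvWishart c r m S) =
      ∫⁻ s, ∫⁻ μ, H (μ, s) ∂(normalLaw c (r⁻¹ • symMatrix s)) ∂(invWishartMeasure m S) := by
  have hker : Measurable fun s => ENNReal.ofReal (invWishartKernel m S (symMatrix s)) :=
    (measurable_invWishartKernel m S).ennreal_ofReal
  have hnormal := (measurable_normalDensity_inv_smul_symMatrix c r).ennreal_ofReal
  have hdens : Measurable fun θ : Param k => ENNReal.ofReal
      (invWishartKernel m S (symMatrix θ.2) * normalDensity c (r⁻¹ • symMatrix θ.2) θ.1) :=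
    (((measurable_invWishartKernel m S).comp measurable_snd).mul
      (measurable_normalDensity_inv_smul_symMatrix c r)).ennreal_ofReal
  have hlaw (s : Sym2 (Fin k) → ℝ) : ∫⁻ μ, H (μ, s) ∂(normalLaw c (r⁻¹ • symMatrix s)) =
      ∫⁻ μ, ENNReal.ofReal (normalDensity c (r⁻¹ • symMatrix s) μ) * H (μ, s) :=
    lintegral_withDensity_eq_lintegral_mul _
      (hnormal.comp measurable_prodMk_right) (hH.comp measurable_prodMk_right)
  have hinner : Measurable fun s : Sym2 (Fin k) → ℝ =>
      ∫⁻ μ, ENNReal.ofReal (normalDensity c (r⁻¹ • symMatrix s) μ) * H (μ, s) :=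
    (hnormal.mul hH).lintegral_prod_left'
  simp only [hlaw]
  rw [normalInvWishart, volume_restrict_posDef_symMatrix_snd,
    lintegral_withDensity_eq_lintegral_mul _ hdens hH,
    lintegral_prod_symm _ (hdens.mul hH).aemeasurable, invWishartMeasure,
    lintegral_withDensity_eq_lintegral_mul _ hker hinner]
  refine setLIntegral_congr_fun measurableSet_posDefSet fun s hs => ?_
  rw [Pi.mul_apply, ← lintegral_const_mul' _ _ ENNReal.ofReal_ne_top]
  refine lintegral_congr fun μ => ?_
  rw [Pi.mul_apply, ENNReal.ofReal_mul (invWishartKernel_pos m S hs).le, mul_assoc]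

lemma ae_posDef_invWishartMeasure (m : ℝ) (S : Matrix (Fin k) (Fin k) ℝ) :
    ∀ᵐ s ∂(invWishartMeasure m S), (symMatrix s).PosDef :=
  (withDensity_absolutelyContinuous _ _).ae_le (ae_restrict_mem measurableSet_posDefSet)

lemma ae_posDef_normalInvWishart (c : Fin k → ℝ) (r m : ℝ) (S : Matrix (Fin k) (Fin k) ℝ) :
    ∀ᵐ θ ∂(normalInvWishart c r m S), (symMatrix θ.2).PosDef :=
  (withDensity_absolutelyContinuous _ _).ae_le
    (ae_restrict_mem (measurable_snd measurableSet_posDefSet))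

lemma normalInvWishart_univ (c : Fin k → ℝ) {r : ℝ} (hr : 0 < r) (m : ℝ)
    (S : Matrix (Fin k) (Fin k) ℝ) :
    normalInvWishart c r m S Set.univ = invWishartMeasure m S Set.univ := by
  rw [← lintegral_one, lintegral_normalInvWishart c r m S measurable_const, ← lintegral_one]
  refine lintegral_congr_ae ?_
  filter_upwards [ae_posDef_invWishartMeasure m S] with s hs
  have := isProbabilityMeasure_normalLaw c (hs.smul (inv_pos.mpr hr))
  rw [lintegral_one, measure_univ]

/-- The conditional mean `vᵀ μ` and variance `vᵀ Σ v` of the portfolio return `vᵀ X` given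
`(μ, Σ)`. -/
def portfolioMoments (v : Fin k → ℝ) (θ : Param k) : ℝ × ℝ :=
  (v ⬝ᵥ θ.1, v ⬝ᵥ (symMatrix θ.2 *ᵥ v))

lemma measurable_portfolioMoments (v : Fin k → ℝ) : Measurable (portfolioMoments v) := by
  have hdot : Measurable fun μ : Fin k → ℝ => v ⬝ᵥ μ := by fun_prop
  exact (hdot.comp measurable_fst).prodMk ((measurable_quadForm v).comp measurable_snd)

lemma map_portfolioMoments_normalInvWishart (c : Fin k → ℝ) {r m : ℝ} (hr : 0 < r)
    (hm : 2 * (k : ℝ) < m) {S : Matrix (Fin k) (Fin k) ℝ} (hS : S.PosDef) (v : Fin k → ℝ) :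
    (normalInvWishart c r m S).map (portfolioMoments v) =
      normalInvWishart c r m S Set.univ •
        ((gaussianReal 0 1).prod (gammaMeasure ((m - 2 * k) / 2) (1 / 2))).map fun p =>
          (v ⬝ᵥ c + √(v ⬝ᵥ (S *ᵥ v) / p.2 / r) * p.1, v ⬝ᵥ (S *ᵥ v) / p.2) := by
  have := isProbabilityMeasure_gammaMeasure (a := (m - 2 * k) / 2) (r := 1 / 2)
    (by linarith) (by norm_num)
  refine Measure.ext_of_lintegral _ fun F hF => ?_
  have hnormal : ∀ᵐ s ∂(invWishartMeasure m S),
      ∫⁻ μ, F (portfolioMoments v (μ, s)) ∂(normalLaw c (r⁻¹ • symMatrix s)) =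
        ∫⁻ y, F (v ⬝ᵥ c + √(v ⬝ᵥ (symMatrix s *ᵥ v) / r) * y, v ⬝ᵥ (symMatrix s *ᵥ v))
          ∂(gaussianReal 0 1) := by
    filter_upwards [ae_posDef_invWishartMeasure m S] with s hs
    unfold portfolioMoments
    rw [← lintegral_map (f := fun a => F (a, v ⬝ᵥ (symMatrix s *ᵥ v))) (g := (v ⬝ᵥ ·))
        (by fun_prop) (by fun_prop),
      map_dotProduct_normalLaw v c (hs.smul (inv_pos.mpr hr)),
      lintegral_map (by fun_prop) (by fun_prop)]
    simp only [Matrix.smul_mulVec, dotProduct_smul, smul_eq_mul, div_eq_inv_mul]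
  have hG : Measurable fun q : ℝ =>
      ∫⁻ y, F (v ⬝ᵥ c + √(q / r) * y, q) ∂(gaussianReal 0 1) :=
    Measurable.lintegral_prod_right' (f := fun p : ℝ × ℝ =>
      F (v ⬝ᵥ c + √(p.1 / r) * p.2, p.1)) (by fun_prop)
  rw [lintegral_map hF (measurable_portfolioMoments v),
    lintegral_normalInvWishart c r m S (H := fun θ => F (portfolioMoments v θ))
      (hF.comp (measurable_portfolioMoments v)),
    lintegral_congr_ae hnormal, ← lintegral_map hG (measurable_quadForm v),
    map_quadForm_invWishartMeasure hm hS v, normalInvWishart_univ c hr, lintegral_smul_measure,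
    lintegral_smul_measure, lintegral_map hG (by fun_prop), lintegral_map hF (by fun_prop),
    lintegral_prod_symm _ (by fun_prop)]

end NormalInverseWishart

section Wealth

variable {k : ℕ}

lemma wealthLaw_eq_map_gaussianReal (W rf : ℝ) (v : Fin k → ℝ) {θ : Param k}
    (hθ : (symMatrix θ.2).PosDef) :
    wealthLaw W rf v θ = (gaussianReal 0 1).map fun z =>
      W * (1 + rf + (v ⬝ᵥ θ.1 + √(v ⬝ᵥ (symMatrix θ.2 *ᵥ v)) * z - v ⬝ᵥ fun _ => rf)) := by
  have hdot : wealth W rf v =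
      (fun a => W * (1 + rf + (a - v ⬝ᵥ fun _ => rf))) ∘ (v ⬝ᵥ ·) := by
    ext X
    simp only [wealth, dotProduct_sub, Function.comp_apply]
  rw [wealthLaw, hdot, ← Measure.map_map (by fun_prop) (by fun_prop),
    map_dotProduct_normalLaw v θ.1 hθ, Measure.map_map (by fun_prop) (by fun_prop)]
  rfl

lemma bind_wealthLaw_eq_map_prod (W rf : ℝ) (v : Fin k → ℝ) {ν : Measure (Param k)} [SFinite ν]
    (hν : ∀ᵐ θ ∂ν, (symMatrix θ.2).PosDef) :
    ν.bind (wealthLaw W rf v) =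
      ((ν.map (portfolioMoments v)).prod (gaussianReal 0 1)).map fun p =>
        W * (1 + rf + (p.1.1 + √p.1.2 * p.2 - v ⬝ᵥ fun _ => rf)) := by
  refine Measure.ext_of_lintegral _ fun F hF => ?_
  rw [Measure.lintegral_bind (measurable_wealthLaw W rf v).aemeasurable hF.aemeasurable,
    lintegral_map hF (by fun_prop), lintegral_prod _ (by fun_prop),
    lintegral_map _ (measurable_portfolioMoments v)]
  · refine lintegral_congr_ae ?_
    filter_upwards [hν] with θ hθ
    rw [wealthLaw_eq_map_gaussianReal W rf v hθ, lintegral_map hF (by fun_prop)]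
    rfl
  · exact Measurable.lintegral_prod_right' (f := fun p : (ℝ × ℝ) × ℝ =>
      F (W * (1 + rf + (p.1.1 + √p.1.2 * p.2 - v ⬝ᵥ fun _ => rf)))) (by fun_prop)

lemma bind_wealthLaw_normalInvWishart (c : Fin k → ℝ) {r m : ℝ} (hr : 0 < r)
    (hm : 2 * (k : ℝ) < m) {S : Matrix (Fin k) (Fin k) ℝ} (hS : S.PosDef) (v : Fin k → ℝ)
    (W rf : ℝ) :
    (normalInvWishart c r m S).bind (wealthLaw W rf v) =
      normalInvWishart c r m S Set.univ • (studentPair (m - 2 * k)).map fun p =>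
        W * (1 + rf + v ⬝ᵥ (c - fun _ => rf) + √(v ⬝ᵥ (S *ᵥ v)) * (p.1 / √r + p.2)) := by
  have := isProbabilityMeasure_gammaMeasure (a := (m - 2 * k) / 2) (r := 1 / 2)
    (by linarith) (by norm_num)
  have : SFinite (normalInvWishart c r m S) := by unfold normalInvWishart; infer_instance
  have hQ : 0 ≤ v ⬝ᵥ (S *ᵥ v) := by simpa using hS.posSemidef.dotProduct_mulVec_nonneg v
  rw [bind_wealthLaw_eq_map_prod W rf v (ae_posDef_normalInvWishart c r m S),
    map_portfolioMoments_normalInvWishart c hr hm hS v, Measure.prod_smul_left,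
    Measure.map_smul, studentPair, Measure.map_map (by fun_prop) (by fun_prop)]
  congr 1
  nth_rewrite 2 [← Measure.map_id (μ := gaussianReal 0 1)]
  rw [Measure.map_prod_map _ _ (by fun_prop) measurable_id,
    Measure.map_map (by fun_prop) (by fun_prop)]
  congr 1
  ext p
  simp only [Function.comp_apply, Prod.map, id_eq, dotProduct_sub,
    Real.sqrt_div' _ hr.le, Real.sqrt_div hQ]
  ring

lemma bind_wealthLaw_normalInvWishart_eq_map_studentT (c : Fin k → ℝ) {r m : ℝ} (hr : 0 < r)
    (hm : 2 * (k : ℝ) < m) {S : Matrix (Fin k) (Fin k) ℝ} (hS : S.PosDef) (v : Fin k → ℝ)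
    (W rf : ℝ) :
    (normalInvWishart c r m S).bind (wealthLaw W rf v) = normalInvWishart c r m S Set.univ •
      ((studentT (m - 2 * k)).prod (studentT (m - 2 * k + 1))).map fun p =>
        W * (1 + rf + v ⬝ᵥ (c - fun _ => rf) + √(v ⬝ᵥ (S *ᵥ v)) * (p.1 / √(r * (m - 2 * k)) +
          √(1 + p.1 ^ 2 / (m - 2 * k)) * (p.2 / √(m - 2 * k + 1)))) := by
  have hd : 0 < m - 2 * (k : ℝ) := by linarith
  rw [bind_wealthLaw_normalInvWishart c hr hm hS v, studentPair_eq_map_prod hd,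
    Measure.map_map (by fun_prop) (by fun_prop)]
  congr 2
  ext p
  simp only [Function.comp_apply, div_div, ← Real.sqrt_mul hd.le, mul_comm r]

end Wealth

section Posterior

variable {k n : ℕ} {x : Fin n → Fin k → ℝ}
  {prior : (Fin k → ℝ) → Matrix (Fin k) (Fin k) ℝ → ℝ} {C r m : ℝ} {c : Fin k → ℝ}
  {S : Matrix (Fin k) (Fin k) ℝ}

lemma posterior_eq_smul_normalInvWishart (hC : 0 < C)
    (h : ∀ μ Sg, Sg.PosDef → likelihood x μ Sg * prior μ Sg =
      C * (invWishartKernel m S Sg * normalDensity c (r⁻¹ • Sg) μ)) :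
    posterior x prior =
      (normalInvWishart c r m S Set.univ)⁻¹ • normalInvWishart c r m S := by
  have hC0 : ENNReal.ofReal C ≠ 0 := by simpa using hC
  have hprop : unnormalizedPosterior x prior = ENNReal.ofReal C • normalInvWishart c r m S := by
    rw [normalInvWishart, ← withDensity_smul' _ _ ENNReal.ofReal_ne_top]
    refine withDensity_congr_ae ?_
    filter_upwards [ae_restrict_mem (measurable_snd measurableSet_posDefSet)] with θ hθ
    rw [h _ _ hθ, ENNReal.ofReal_mul hC.le, Pi.smul_apply, smul_eq_mul]
  rw [posterior, hprop, Measure.smul_apply, smul_eq_mul,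
    ENNReal.mul_inv (.inl hC0) (.inl ENNReal.ofReal_ne_top), smul_smul, mul_right_comm,
    ENNReal.inv_mul_cancel hC0 ENNReal.ofReal_ne_top, one_mul]

lemma isProbabilityMeasure_of_posterior_eq (hr : 0 < r) (hm : 2 * (k : ℝ) < m) (hS : S.PosDef)
    (h : posterior x prior = (normalInvWishart c r m S Set.univ)⁻¹ • normalInvWishart c r m S) :
    IsProbabilityMeasure (posterior x prior) := by
  obtain ⟨h0, htop⟩ := invWishartMeasure_univ hm hS
  rw [← normalInvWishart_univ c hr] at h0 htop
  exact ⟨by rw [h, Measure.smul_apply, smul_eq_mul, ENNReal.inv_mul_cancel h0 htop]⟩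

lemma hasLaw_predictiveWealth (hr : 0 < r) (hm : 2 * (k : ℝ) < m) (hS : S.PosDef)
    (h : posterior x prior = (normalInvWishart c r m S Set.univ)⁻¹ • normalInvWishart c r m S)
    (v : Fin k → ℝ) (W rf : ℝ) {Ω : Type*} [MeasurableSpace Ω] {P : Measure Ω}
    [IsFiniteMeasure P] {t₁ t₂ : Ω → ℝ} (h₁ : HasLaw t₁ (studentT (m - 2 * k)) P)
    (h₂ : HasLaw t₂ (studentT (m - 2 * k + 1)) P) (hind : IndepFun t₁ t₂ P) :
    HasLaw (fun ω => W * (1 + rf + v ⬝ᵥ (c - fun _ => rf) + √(v ⬝ᵥ (S *ᵥ v)) *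
          (t₁ ω / √(r * (m - 2 * k)) +
            √(1 + t₁ ω ^ 2 / (m - 2 * k)) * (t₂ ω / √(m - 2 * k + 1)))))
      (predictiveWealth x prior W rf v) P := by
  obtain ⟨h0, htop⟩ := invWishartMeasure_univ hm hS
  rw [← normalInvWishart_univ c hr] at h0 htop
  refine HasLaw.comp (Y := fun p : ℝ × ℝ => W * (1 + rf + v ⬝ᵥ (c - fun _ => rf) +
    √(v ⬝ᵥ (S *ᵥ v)) * (p.1 / √(r * (m - 2 * k)) +
      √(1 + p.1 ^ 2 / (m - 2 * k)) * (p.2 / √(m - 2 * k + 1))))) ⟨by fun_prop, ?_⟩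
    (hind.hasLaw_prod h₁ h₂)
  rw [predictiveWealth, h, Measure.bind_smul, bind_wealthLaw_normalInvWishart_eq_map_studentT c hr
    hm hS, smul_smul, ENNReal.inv_mul_cancel h0 htop, one_smul]

end Posterior

section Likelihood

variable {k n : ℕ}

lemma sum_sub_sampleMean (x : Fin n → Fin k → ℝ) : ∑ i, (x i - sampleMean x) = 0 := by
  rcases n.eq_zero_or_pos with rfl | hn
  · simp
  have hn' : (n : ℝ) ≠ 0 := by positivity
  rw [Finset.sum_sub_distrib, Finset.sum_const, Finset.card_univ, Fintype.card_fin, sampleMean,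
    ← Nat.cast_smul_eq_nsmul ℝ, smul_smul, mul_inv_cancel₀ hn', one_smul, sub_self]

lemma diffuseScale_eq_sum (x : Fin n → Fin k → ℝ) :
    diffuseScale x = ∑ i, Matrix.vecMulVec (x i - sampleMean x) (x i - sampleMean x) := by
  by_cases hn : n = 1
  · subst hn
    have h := sum_sub_sampleMean x
    rw [Fin.sum_univ_one] at h
    simp [diffuseScale, h]
  · have hn' : (n : ℝ) - 1 ≠ 0 := sub_ne_zero.mpr (by exact_mod_cast hn)
    rw [diffuseScale, sampleCov, smul_smul, mul_inv_cancel₀ hn', one_smul]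

lemma posSemidef_vecMulVec_self (a : Fin k → ℝ) : (Matrix.vecMulVec a a).PosSemidef := by
  simpa using Matrix.posSemidef_vecMulVec_self_star a

lemma posSemidef_diffuseScale (x : Fin n → Fin k → ℝ) : (diffuseScale x).PosSemidef := by
  rw [diffuseScale_eq_sum]
  exact Matrix.posSemidef_sum _ fun i _ => posSemidef_vecMulVec_self _

lemma posDef_conjugateScale (x : Fin n → Fin k → ℝ) (m₀ : Fin k → ℝ) {r₀ : ℝ} (hr : 0 < r₀)
    {S₀ : Matrix (Fin k) (Fin k) ℝ} (hS₀ : S₀.PosDef) : (conjugateScale x m₀ r₀ S₀).PosDef :=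
  (hS₀.posSemidef_add (posSemidef_diffuseScale x)).add_posSemidef
    ((posSemidef_vecMulVec_self _).smul (by positivity))

lemma trace_mul_vecMulVec_self (M : Matrix (Fin k) (Fin k) ℝ) (a : Fin k → ℝ) :
    (M * Matrix.vecMulVec a a).trace = a ⬝ᵥ (M *ᵥ a) := by
  rw [Matrix.mul_vecMulVec, Matrix.trace_vecMulVec, dotProduct_comm]

lemma quadForm_add (M : Matrix (Fin k) (Fin k) ℝ) (a b : Fin k → ℝ) :
    (a + b) ⬝ᵥ (M *ᵥ (a + b)) =
      a ⬝ᵥ (M *ᵥ a) + a ⬝ᵥ (M *ᵥ b) + b ⬝ᵥ (M *ᵥ a) + b ⬝ᵥ (M *ᵥ b) := by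
  rw [Matrix.mulVec_add, dotProduct_add, add_dotProduct, add_dotProduct]
  ring

lemma sum_quadForm_sub (x : Fin n → Fin k → ℝ) (M : Matrix (Fin k) (Fin k) ℝ)
    (μ : Fin k → ℝ) :
    ∑ i, (x i - μ) ⬝ᵥ (M *ᵥ (x i - μ)) =
      (M * diffuseScale x).trace +
        n * ((μ - sampleMean x) ⬝ᵥ (M *ᵥ (μ - sampleMean x))) := by
  have hexpand (i : Fin n) : (x i - μ) ⬝ᵥ (M *ᵥ (x i - μ)) =
      (x i - sampleMean x) ⬝ᵥ (M *ᵥ (x i - sampleMean x)) +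
      (x i - sampleMean x) ⬝ᵥ (M *ᵥ (sampleMean x - μ)) +
      (sampleMean x - μ) ⬝ᵥ (M *ᵥ (x i - sampleMean x)) +
      (sampleMean x - μ) ⬝ᵥ (M *ᵥ (sampleMean x - μ)) := by
    rw [← quadForm_add, sub_add_sub_cancel]
  have hneg : (sampleMean x - μ) ⬝ᵥ (M *ᵥ (sampleMean x - μ)) =
      (μ - sampleMean x) ⬝ᵥ (M *ᵥ (μ - sampleMean x)) := by
    rw [← neg_sub μ, Matrix.mulVec_neg, neg_dotProduct_neg]
  simp only [hexpand, Finset.sum_add_distrib]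
  rw [← sum_dotProduct, ← dotProduct_sum, ← Matrix.mulVec_sum, sum_sub_sampleMean,
    zero_dotProduct, Matrix.mulVec_zero, dotProduct_zero, diffuseScale_eq_sum, Matrix.mul_sum,
    Matrix.trace_sum, Finset.sum_const, Finset.card_univ, Fintype.card_fin, nsmul_eq_mul, hneg]
  simp only [trace_mul_vecMulVec_self, add_zero]

lemma likelihood_eq (x : Fin n → Fin k → ℝ) (μ : Fin k → ℝ)
    {S : Matrix (Fin k) (Fin k) ℝ} (hS : S.PosDef) :
    likelihood x μ S = ((2 * Real.pi) ^ (-(k : ℝ) / 2)) ^ n * S.det ^ (-(n : ℝ) / 2) *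
      Real.exp (-(1 / 2) * ((S⁻¹ * diffuseScale x).trace +
        n * ((μ - sampleMean x) ⬝ᵥ (S⁻¹ *ᵥ (μ - sampleMean x))))) := by
  simp only [likelihood, normalDensity]
  rw [Finset.prod_mul_distrib, ← Real.exp_sum, Finset.prod_const, Finset.card_univ,
    Fintype.card_fin, ← Finset.mul_sum, sum_quadForm_sub, mul_pow,
    ← Real.rpow_natCast (S.det ^ _), ← Real.rpow_mul hS.det_pos.le]
  congr 3
  ring

lemma quadForm_conjugate (x : Fin n → Fin k → ℝ) (M : Matrix (Fin k) (Fin k) ℝ)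
    (μ m₀ : Fin k → ℝ) {r₀ : ℝ} (hr : 0 < r₀) (S₀ : Matrix (Fin k) (Fin k) ℝ) :
    (M * diffuseScale x).trace + n * ((μ - sampleMean x) ⬝ᵥ (M *ᵥ (μ - sampleMean x))) +
      r₀ * ((μ - m₀) ⬝ᵥ (M *ᵥ (μ - m₀))) + (M * S₀).trace =
    (M * conjugateScale x m₀ r₀ S₀).trace + (n + r₀) *
      ((μ - conjugateMean x m₀ r₀) ⬝ᵥ (M *ᵥ (μ - conjugateMean x m₀ r₀))) := by
  have hnr : (n : ℝ) + r₀ ≠ 0 := by positivity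
  set a := μ - sampleMean x with ha
  set b := μ - m₀ with hb
  have hmean : μ - conjugateMean x m₀ r₀ = ((n : ℝ) + r₀)⁻¹ • ((n : ℝ) • a + r₀ • b) := by
    ext i
    simp only [conjugateMean, ha, hb, Pi.sub_apply, Pi.smul_apply, Pi.add_apply, smul_eq_mul]
    field_simp
    ring
  have hdiff : m₀ - sampleMean x = a + -b := by rw [ha, hb]; abel
  rw [conjugateScale, Matrix.mul_add, Matrix.mul_add, Matrix.trace_add, Matrix.trace_add,
    Matrix.mul_smul, Matrix.trace_smul, trace_mul_vecMulVec_self, hmean, hdiff, Matrix.mulVec_smul,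
    smul_dotProduct, dotProduct_smul, quadForm_add, quadForm_add]
  simp only [Matrix.mulVec_smul, Matrix.mulVec_neg, smul_dotProduct, dotProduct_smul,
    neg_dotProduct, dotProduct_neg, smul_eq_mul, neg_neg]
  field_simp
  ring

end Likelihood

section Priors

variable {k n : ℕ}

lemma exists_likelihood_mul_diffusePrior (hn : 0 < n) (x : Fin n → Fin k → ℝ) :
    ∃ C : ℝ, 0 < C ∧ ∀ μ Sg, Sg.PosDef → likelihood x μ Sg * diffusePrior μ Sg =
      C * (invWishartKernel (n + k) (diffuseScale x) Sg *
        normalDensity (sampleMean x) ((n : ℝ)⁻¹ • Sg) μ) := by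
  have hn' : (0 : ℝ) < n := by exact_mod_cast hn
  set N := (2 * Real.pi) ^ (-(k : ℝ) / 2) * (n : ℝ)⁻¹ ^ (-(k : ℝ) / 2) with hN
  have hN0 : 0 < N := by positivity
  refine ⟨((2 * Real.pi) ^ (-(k : ℝ) / 2)) ^ n / N, by positivity, fun μ Sg hS => ?_⟩
  have hdet : Sg.det ^ (-(n : ℝ) / 2) * Sg.det ^ (-((k : ℝ) + 1) / 2) =
      Sg.det ^ (-((n : ℝ) + k) / 2) * Sg.det ^ (-(1 : ℝ) / 2) := by
    rw [← Real.rpow_add hS.det_pos, ← Real.rpow_add hS.det_pos]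
    congr 1
    ring
  rw [likelihood_eq x μ hS, normalDensity_smul _ (inv_pos.2 hn') hS, ← hN, inv_inv,
    diffusePrior, invWishartKernel, mul_add, Real.exp_add, div_mul_eq_mul_div, eq_div_iff hN0.ne']
  linear_combination ((2 * Real.pi) ^ (-(k : ℝ) / 2)) ^ n *
    Real.exp (-(1 / 2) * (Sg⁻¹ * diffuseScale x).trace) *
    Real.exp (-(1 / 2) * (n * ((μ - sampleMean x) ⬝ᵥ (Sg⁻¹ *ᵥ (μ - sampleMean x))))) * N * hdet

lemma posterior_diffusePrior (hn : 0 < n) (x : Fin n → Fin k → ℝ) :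
    posterior x diffusePrior =
      (normalInvWishart (sampleMean x) n (n + k) (diffuseScale x) Set.univ)⁻¹ •
        normalInvWishart (sampleMean x) n (n + k) (diffuseScale x) := by
  obtain ⟨C, hC, h⟩ := exists_likelihood_mul_diffusePrior hn x
  exact posterior_eq_smul_normalInvWishart hC h

lemma multivariateGamma_pos {a : ℝ} (ha : (k : ℝ) - 1 < 2 * a) : 0 < multivariateGamma k a := by
  refine mul_pos (by positivity) (Finset.prod_pos fun i _ => Real.Gamma_pos_of_pos ?_)
  have : ((i : ℕ) : ℝ) + 1 ≤ k := by exact_mod_cast i.isLt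
  linarith

lemma exists_invWishartDensity_eq {d₀ : ℝ} {S₀ : Matrix (Fin k) (Fin k) ℝ}
    (hd : 2 * (k : ℝ) < d₀) (hS₀ : S₀.PosDef) :
    ∃ K : ℝ, 0 < K ∧ ∀ Sg, invWishartDensity d₀ S₀ Sg = K * invWishartKernel d₀ S₀ Sg := by
  have hdet := hS₀.det_pos
  have hΓ : 0 < multivariateGamma k ((d₀ - k - 1) / 2) := multivariateGamma_pos (by linarith)
  exact ⟨_, by positivity, fun Sg => mul_assoc _ _ _⟩

lemma exists_likelihood_mul_conjugatePrior (x : Fin n → Fin k → ℝ) (m₀ : Fin k → ℝ)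
    {r₀ d₀ : ℝ} {S₀ : Matrix (Fin k) (Fin k) ℝ} (hr : 0 < r₀) (hd : 2 * (k : ℝ) < d₀)
    (hS₀ : S₀.PosDef) :
    ∃ C : ℝ, 0 < C ∧ ∀ μ Sg, Sg.PosDef → likelihood x μ Sg * conjugatePrior m₀ r₀ d₀ S₀ μ Sg =
      C * (invWishartKernel (n + d₀) (conjugateScale x m₀ r₀ S₀) Sg *
        normalDensity (conjugateMean x m₀ r₀) (((n : ℝ) + r₀)⁻¹ • Sg) μ) := by
  have hnr : 0 < (n : ℝ) + r₀ := by positivity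
  obtain ⟨K, hK, hprior⟩ := exists_invWishartDensity_eq hd hS₀
  set N := (2 * Real.pi) ^ (-(k : ℝ) / 2) * ((n : ℝ) + r₀)⁻¹ ^ (-(k : ℝ) / 2) with hN
  have hN0 : 0 < N := by positivity
  refine ⟨((2 * Real.pi) ^ (-(k : ℝ) / 2)) ^ n *
    ((2 * Real.pi) ^ (-(k : ℝ) / 2) * r₀⁻¹ ^ (-(k : ℝ) / 2)) * K / N, by positivity,
    fun μ Sg hS => ?_⟩
  have hdet : Sg.det ^ (-(n : ℝ) / 2) * Sg.det ^ (-d₀ / 2) = Sg.det ^ (-((n : ℝ) + d₀) / 2) := by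
    rw [← Real.rpow_add hS.det_pos]
    congr 1
    ring
  have hexp := congrArg (fun y => Real.exp (-(1 / 2) * y))
    (quadForm_conjugate x Sg⁻¹ μ m₀ hr S₀)
  simp only [mul_add (-(1 / 2) : ℝ), Real.exp_add] at hexp
  rw [likelihood_eq x μ hS, conjugatePrior, hprior, normalDensity_smul _ (inv_pos.2 hr) hS,
    normalDensity_smul _ (inv_pos.2 hnr) hS, ← hN, inv_inv, inv_inv, invWishartKernel,
    invWishartKernel, mul_add, Real.exp_add, div_mul_eq_mul_div, eq_div_iff hN0.ne', ← hdet]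
  linear_combination ((2 * Real.pi) ^ (-(k : ℝ) / 2)) ^ n *
    ((2 * Real.pi) ^ (-(k : ℝ) / 2) * r₀⁻¹ ^ (-(k : ℝ) / 2)) * K * N *
    Sg.det ^ (-(n : ℝ) / 2) * Sg.det ^ (-d₀ / 2) * Sg.det ^ (-(1 : ℝ) / 2) * hexp

lemma posterior_conjugatePrior (x : Fin n → Fin k → ℝ) (m₀ : Fin k → ℝ) {r₀ d₀ : ℝ}
    {S₀ : Matrix (Fin k) (Fin k) ℝ} (hr : 0 < r₀) (hd : 2 * (k : ℝ) < d₀) (hS₀ : S₀.PosDef) :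
    posterior x (conjugatePrior m₀ r₀ d₀ S₀) =
      (normalInvWishart (conjugateMean x m₀ r₀) (n + r₀) (n + d₀)
          (conjugateScale x m₀ r₀ S₀) Set.univ)⁻¹ •
        normalInvWishart (conjugateMean x m₀ r₀) (n + r₀) (n + d₀)
          (conjugateScale x m₀ r₀ S₀) := by
  obtain ⟨C, hC, h⟩ := exists_likelihood_mul_conjugatePrior x m₀ hr hd hS₀
  exact posterior_eq_smul_normalInvWishart hC h

end Priors

theorem theorem6_general {k n : ℕ} (x : Fin n → Fin k → ℝ) (v : Fin k → ℝ) (W rf : ℝ) :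
    (k < n → (diffuseScale x).PosDef →
      IsProbabilityMeasure (posterior x diffusePrior) ∧
      ∀ {Ω : Type*} [MeasurableSpace Ω] (P : Measure Ω) [IsProbabilityMeasure P] (t₁ t₂ : Ω → ℝ),
        HasLaw t₁ (studentT ((n : ℝ) - k)) P →
        HasLaw t₂ (studentT ((n : ℝ) - k + 1)) P →
        IndepFun t₁ t₂ P →
        HasLaw (fun ω =>
            W * (1 + rf + v ⬝ᵥ (sampleMean x - fun _ => rf) +
              √(v ⬝ᵥ (diffuseScale x *ᵥ v)) *
                (t₁ ω / √((n : ℝ) * ((n : ℝ) - k)) +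
                  √(1 + t₁ ω ^ 2 / ((n : ℝ) - k)) * (t₂ ω / √((n : ℝ) - k + 1)))))
          (predictiveWealth x diffusePrior W rf v) P) ∧
    (∀ (m₀ : Fin k → ℝ) (r₀ d₀ : ℝ) (S₀ : Matrix (Fin k) (Fin k) ℝ),
      0 < r₀ → 2 * (k : ℝ) < d₀ → S₀.PosDef →
      IsProbabilityMeasure (posterior x (conjugatePrior m₀ r₀ d₀ S₀)) ∧
      ∀ {Ω : Type*} [MeasurableSpace Ω] (P : Measure Ω) [IsProbabilityMeasure P] (t₁ t₂ : Ω → ℝ),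
        HasLaw t₁ (studentT ((n : ℝ) + d₀ - 2 * k)) P →
        HasLaw t₂ (studentT ((n : ℝ) + d₀ - 2 * k + 1)) P →
        IndepFun t₁ t₂ P →
        HasLaw (fun ω =>
            W * (1 + rf + v ⬝ᵥ (conjugateMean x m₀ r₀ - fun _ => rf) +
              √(v ⬝ᵥ (conjugateScale x m₀ r₀ S₀ *ᵥ v)) *
                (t₁ ω / √(((n : ℝ) + r₀) * ((n : ℝ) + d₀ - 2 * k)) +
                  √(1 + t₁ ω ^ 2 / ((n : ℝ) + d₀ - 2 * k)) *
                    (t₂ ω / √((n : ℝ) + d₀ - 2 * k + 1)))))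
          (predictiveWealth x (conjugatePrior m₀ r₀ d₀ S₀) W rf v) P) := by
  refine ⟨fun hkn hS => ?_, fun m₀ r₀ d₀ S₀ hr hd hS₀ => ?_⟩
  · have hn : 0 < n := by omega
    have hn' : (0 : ℝ) < n := by exact_mod_cast hn
    have hm : 2 * (k : ℝ) < n + k := by
      have : (k : ℝ) < n := by exact_mod_cast hkn
      linarith
    have hdeg : (n : ℝ) - k = n + k - 2 * k := by ring
    have hpost := posterior_diffusePrior hn x
    simp only [hdeg]
    exact ⟨isProbabilityMeasure_of_posterior_eq hn' hm hS hpost, fun _ _ _ _ h₁ h₂ hind =>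
      hasLaw_predictiveWealth hn' hm hS hpost v W rf h₁ h₂ hind⟩
  · have hr' : 0 < (n : ℝ) + r₀ := by positivity
    have hm : 2 * (k : ℝ) < n + d₀ := hd.trans_le (by simp)
    have hS := posDef_conjugateScale x m₀ hr hS₀
    have hpost := posterior_conjugatePrior x m₀ hr hd hS₀
    exact ⟨isProbabilityMeasure_of_posterior_eq hr' hm hS hpost, fun _ _ _ _ h₁ h₂ hind =>
      hasLaw_predictiveWealth hr' hm hS hpost v W rf h₁ h₂ hind⟩

end BayesPortfolio

open BayesPortfolio in
theorem theorem6 {k n : ℕ} (hkn : k < n) (x : Fin n → Fin k → ℝ)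
    (v : Fin k → ℝ) (W rf : ℝ) :
    -- (a) diffuse prior
    ((diffuseScale x).PosDef →
      IsProbabilityMeasure (posterior x diffusePrior) ∧
      ∀ {Ω : Type*} [MeasurableSpace Ω] (P : Measure Ω) [IsProbabilityMeasure P] (t₁ t₂ : Ω → ℝ),
        HasLaw t₁ (studentT ((n : ℝ) - k)) P →
        HasLaw t₂ (studentT ((n : ℝ) - k + 1)) P →
        IndepFun t₁ t₂ P →
        HasLaw (fun ω =>
            W * (1 + rf + v ⬝ᵥ (sampleMean x - fun _ => rf) +
              √(v ⬝ᵥ (diffuseScale x *ᵥ v)) *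
                (t₁ ω / √((n : ℝ) * ((n : ℝ) - k)) +
                  √(1 + t₁ ω ^ 2 / ((n : ℝ) - k)) * (t₂ ω / √((n : ℝ) - k + 1)))))
          (predictiveWealth x diffusePrior W rf v) P) ∧
    -- (b) conjugate prior
    (∀ (m₀ : Fin k → ℝ) (r₀ d₀ : ℝ) (S₀ : Matrix (Fin k) (Fin k) ℝ),
      0 < r₀ → 2 * (k : ℝ) < d₀ → S₀.PosDef →
      IsProbabilityMeasure (posterior x (conjugatePrior m₀ r₀ d₀ S₀)) ∧
      ∀ {Ω : Type*} [MeasurableSpace Ω] (P : Measure Ω) [IsProbabilityMeasure P] (t₁ t₂ : Ω → ℝ),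
        HasLaw t₁ (studentT ((n : ℝ) + d₀ - 2 * k)) P →
        HasLaw t₂ (studentT ((n : ℝ) + d₀ - 2 * k + 1)) P →
        IndepFun t₁ t₂ P →
        HasLaw (fun ω =>
            W * (1 + rf + v ⬝ᵥ (conjugateMean x m₀ r₀ - fun _ => rf) +
              √(v ⬝ᵥ (conjugateScale x m₀ r₀ S₀ *ᵥ v)) *
                (t₁ ω / √(((n : ℝ) + r₀) * ((n : ℝ) + d₀ - 2 * k)) +
                  √(1 + t₁ ω ^ 2 / ((n : ℝ) + d₀ - 2 * k)) *
                    (t₂ ω / √((n : ℝ) + d₀ - 2 * k + 1)))))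
          (predictiveWealth x (conjugatePrior m₀ r₀ d₀ S₀) W rf v) P) :=
  (theorem6_general x v W rf).imp_left fun h => h hkn
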